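/- Let $k\ge 1$ and let $G$ and $H$ be finite simple graphs. Then the following are equivalent: 1. For every finite simple graph $F$ of treewidth at most $k$, the number of graph homomorphisms $F\to G$ equals the number of graph homomorphisms $F\to H$. (Treewidth at most $k$ means that $F$ has a tree decomposition all of whose bags have at most $k+1$ vertices.) 2. The system $\mathsf{PW}^{k+1}(G,H)$ has a non-negative rational solution: there is a matrix $X\in\mathbb{Q}_{\ge 0}^{V(H)^{k+1}\times V(G)^{k+1}}$ all of whose row sums and column sums equal $1$ and such that $X\boldsymbol{B}_G=\boldsymbol{B}_H X$ for all $\boldsymbol{B}\in\mathcal{B}^k$. 3. The system $\mathsf{L}_{\mathrm{iso}}^{k+1}(G,H)$ has a non-negative rational solution: there are numbers $Y_\pi\in\mathbb{Q}_{\ge 0}$, for $\pi\subseteq V(H)\times V(G)$ with $|\pi|\le k+1$, such that - $\sum_{v\in V(G)}Y_{\pi\cup\{(w,v)\}}=Y_\pi$ for all $\pi$ with $|\pi|\le k$ and all $w\in V(H)$, - $\sum_{w\in V(H)}Y_{\pi\cup\{(w,v)\}}=Y_\pi$ for all $\pi$ with $|\pi|\le k$ and all $v\in V(G)$, - $Y_\emptyset=1$,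 - $Y_\pi=0$ for all $\pi$ with $|\pi|\le k+1$ that are not partial isomorphisms. Here a set $\pi\subseteq V(H)\times V(G)$ is a partial isomorphism if for all $(w,v),(w',v')\in\pi$ we have $v=v'\iff w=w'$ and $vv'\in E(G)\iff ww'\in E(H)$. A $(k+1,k+1)$-bilabelled graph $\boldsymbol{B}=(B,\vec a,\vec b)$ is a finite simple graph $B$ with tuples $\vec a,\vec b\in V(B)^{k+1}$ of in- and out-labelled vertices (not necessarily distinct), and $\boldsymbol{B}_G\in\mathbb{Q}^{V(G)^{k+1}\times V(G)^{k+1}}$ is the matrix whose entry at $(\vec x,\vec y)$ is the number of homomorphisms $h\colon B\to G$ with $h(a_i)=x_i$ and $h(b_i)=y_i$ for all $i$. The set $\mathcal{B}^k$ consists of the following bilabelled graphs, where $1\le i\ne j\le k+1$: - the identity graph $\boldsymbol{I}$ with vertex set $\{1,\dots,k+1\}$, no edges, and $\vec a=\vec b=(1,\dots,k+1)$; - the adjacency graphs $\boldsymbol{A}^{ij}$, obtained from $\boldsymbol{I}$ by adding the edge $ij$; - the identification graphs $\boldsymbol{I}^{ij}$ with vertex set $\{1,\dots,k+1\}\setminus\{j\}$,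 no edges, and $\vec a=\vec b$ the tuple $(1,\dots,k+1)$ with its $j$-th entry replaced by $i$; - the forgetting graphs $\boldsymbol{F}^i$ with vertex set $\{1,\dots,k+1\}\cup\{i'\}$, no edges, $\vec a=(1,\dots,k+1)$, and $\vec b$ the tuple $(1,\dots,k+1)$ with its $i$-th entry replaced by the new vertex $i'$. -/

import Mathlib

/-- A decomposition `(T, bag)` of the graph `F`: the bags cover the vertices and the edges of `F`,
and for every vertex of `F` the set of nodes whose bag contains it is connected in `T`. -/
structure GraphDecomposition {U S : Type*} (F : SimpleGraph U) (T : SimpleGraph S) where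
  bag : S → Finset U
  vertex_mem : ∀ u : U, ∃ s : S, u ∈ bag s
  edge_mem : ∀ u v : U, F.Adj u v → ∃ s : S, u ∈ bag s ∧ v ∈ bag s
  connected : ∀ u : U, (T.induce {s : S | u ∈ bag s}).Connected

/-- The width, i.e. the maximal size of a bag minus one, is at most `k`. -/
def GraphDecomposition.WidthAtMost {U S : Type*} {F : SimpleGraph U} {T : SimpleGraph S}
    (D : GraphDecomposition F T) (k : ℕ) : Prop :=
  ∀ s : S, (D.bag s).card ≤ k + 1

/-- `F` has treewidth at most `k`: it has a decomposition of width at most `k` over a finite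
tree. -/
def TreewidthAtMost {U : Type*} (F : SimpleGraph U) (k : ℕ) : Prop :=
  ∃ (S : Type) (_ : Fintype S) (T : SimpleGraph S) (D : GraphDecomposition F T),
    T.IsTree ∧ D.WidthAtMost k

/-- The number of homomorphisms from `F` to `G`. -/
noncomputable def homCount {U V : Type*} (F : SimpleGraph U) (G : SimpleGraph V) : ℕ :=
  Nat.card (F →g G)

/-- `G` and `H` are homomorphism indistinguishable over the (finite) graphs of treewidth at most
`k`. -/
def HomIndistinguishableTreewidth {V W : Type*} (k : ℕ) (G : SimpleGraph V) (H : SimpleGraph W) :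
    Prop :=
  ∀ (U : Type) [Fintype U] (F : SimpleGraph U),
    TreewidthAtMost F k → homCount F G = homCount F H

/-- An `(a, b)`-bilabelled finite graph; labels may share a vertex. -/
structure BilabelledGraph (a b : ℕ) where
  Vert : Type
  [fintypeVert : Fintype Vert]
  graph : SimpleGraph Vert
  inLabel : Fin a → Vert
  outLabel : Fin b → Vert

/-- The homomorphism matrix of a bilabelled graph: the entry at `(x, y)` counts the homomorphisms
to `G` that send the in-labelled vertices to `x` and the out-labelled vertices to `y`. -/
noncomputable def BilabelledGraph.homMatrix {a b : ℕ} (B : BilabelledGraph a b) {V : Type*}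
    (G : SimpleGraph V) : Matrix (Fin a → V) (Fin b → V) ℚ :=
  fun x y => (Nat.card {h : B.graph →g G //
    (∀ i, h (B.inLabel i) = x i) ∧ (∀ j, h (B.outLabel j) = y j)} : ℚ)

/-- The identity graph: no edges, and the `i`-th vertex carries in-label and out-label `i`. -/
def identityGraph (m : ℕ) : BilabelledGraph m m where
  Vert := Fin m
  graph := ⊥
  inLabel := id
  outLabel := id

/-- The adjacency graph: the identity graph together with the edge `ij`. -/
def adjacencyGraph {m : ℕ} (i j : Fin m) : BilabelledGraph m m where
  Vert := Fin m
  graph := SimpleGraph.fromEdgeSet {s(i, j)}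
  inLabel := id
  outLabel := id

/-- The identification graph: the identity graph without vertex `j`, whose two labels are put on
vertex `i`. -/
def identificationGraph {m : ℕ} (i j : Fin m) (hij : i ≠ j) : BilabelledGraph m m where
  Vert := {l : Fin m // l ≠ j}
  graph := ⊥
  inLabel := fun l => if h : l = j then ⟨i, hij⟩ else ⟨l, h⟩
  outLabel := fun l => if h : l = j then ⟨i, hij⟩ else ⟨l, h⟩

/-- The forgetting graph: the identity graph with one additional isolated vertex (`none`), to which
the out-label `i` is moved. -/
def forgettingGraph {m : ℕ} (i : Fin m) : BilabelledGraph m m where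
  Vert := Option (Fin m)
  graph := ⊥
  inLabel := fun l => some l
  outLabel := fun l => if l = i then none else some l

/-- The basal set of `(k + 1, k + 1)`-bilabelled graphs. -/
def basalSet (k : ℕ) : Set (BilabelledGraph (k + 1) (k + 1)) :=
  {B | B = identityGraph (k + 1) ∨
    (∃ i j : Fin (k + 1), i ≠ j ∧ B = adjacencyGraph i j) ∨
    (∃ (i j : Fin (k + 1)) (hij : i ≠ j), B = identificationGraph i j hij) ∨
    (∃ i : Fin (k + 1), B = forgettingGraph i)}

/-- A pseudo-stochastic matrix: all row sums and all column sums are one. -/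
def IsPseudoStochastic {I J : Type*} [Fintype I] [Fintype J] (X : Matrix I J ℚ) : Prop :=
  (∀ i, ∑ j, X i j = 1) ∧ (∀ j, ∑ i, X i j = 1)

/-- `X` is a rational solution of the system `PW^{k+1}(G, H)`. -/
def IsPWSolution {V W : Type*} [Fintype V] [Fintype W] (k : ℕ) (G : SimpleGraph V)
    (H : SimpleGraph W) (X : Matrix (Fin (k + 1) → W) (Fin (k + 1) → V) ℚ) : Prop :=
  IsPseudoStochastic X ∧ ∀ B ∈ basalSet k, X * B.homMatrix G = B.homMatrix H * X

/-- `π ⊆ V(H) × V(G)` is a partial isomorphism. -/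
def IsPartialIso {V W : Type*} (G : SimpleGraph V) (H : SimpleGraph W) (π : Finset (W × V)) :
    Prop :=
  ∀ p ∈ π, ∀ q ∈ π, (p.2 = q.2 ↔ p.1 = q.1) ∧ (G.Adj p.2 q.2 ↔ H.Adj p.1 q.1)

/-- `Y` is a rational solution of the system `L^{k+1}_iso(G, H)`. The variables of the system are
the values `Y π` with `π.card ≤ k + 1`; no other value of `Y` occurs in it. -/
structure IsLisoSolution {V W : Type*} [Fintype V] [Fintype W] [DecidableEq V] [DecidableEq W]
    (k : ℕ) (G : SimpleGraph V) (H : SimpleGraph W) (Y : Finset (W × V) → ℚ) : Prop where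
  continuity_left : ∀ π : Finset (W × V), π.card ≤ k → ∀ w : W, ∑ v : V, Y (π ∪ {(w, v)}) = Y π
  continuity_right : ∀ π : Finset (W × V), π.card ≤ k → ∀ v : V, ∑ w : W, Y (π ∪ {(w, v)}) = Y π
  empty_eq_one : Y ∅ = 1
  eq_zero : ∀ π : Finset (W × V), π.card ≤ k + 1 → ¬ IsPartialIso G H π → Y π = 0

/-! The basal matrices other than those of the forgetting graphs are diagonal with entries 0 and 1,
and commuting with them means that `X` is supported on pairs of tuples of the same atomic type.
Commuting with the forgetting matrices equates the marginals of `X` at each position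
(`isPWSolution_iff`).

1 to 2: A tree of (k+1)-tuples of variables, identified at nodes and along tree edges, counts
homomorphisms from a graph of treewidth at most k with prescribed root values. Gluing two such trees
at their roots multiplies the counts; a new root sharing all variables but one sums over the freed
position. So on the disjoint union of the tuples over `V` and `W` the span of these counts is an
algebra closed under such summations, and by interpolation it contains the indicator of every class
of tuples with equal counts (`indicator_mem_span`). By hypothesis its elements have equal totals on
both sides, so the classes are balanced, and uniform weights on them form `X`
(`exists_isTupleCoupling`).

2 to 3: The marginal condition lets a repeated pair in a tuple of pairs be overwritten by any other
entry. Once `X` is averaged over permutations of the positions, its value therefore depends only on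
the set of pairs (`eq_of_range_eq`), which defines `Y`.

3 to 1: A homomorphism count is a sum over all maps of a product of bag weights. The weights for `G`
and `H` agree on the support of `Y` (`TransfersOn`). The continuity equations preserve this when a
variable is summed out, and non-negativity preserves it when a bag is enlarged. So leaves of the
decomposition can be absorbed by their neighbours (`IsLisoSolution.sum_prod_eq`); at the end two
constants remain, equal because `Y ∅ = 1`. -/

/-! ### The matrices of the basal graphs and the entrywise form of PW -/

/-- The entrywise form of the system `PW^m(G, H)`: a matrix whose support relates only tuples with
the same atomic type, and whose marginals at each position agree. -/
structure IsTupleCoupling {V W : Type*} [Fintype V] [Fintype W] (m : ℕ) (G : SimpleGraph V)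
    (H : SimpleGraph W) (X : (Fin m → W) → (Fin m → V) → ℚ) : Prop where
  row_sum : ∀ w, ∑ v, X w v = 1
  col_sum : ∀ v, ∑ w, X w v = 1
  eq_iff : ∀ w v, X w v ≠ 0 → ∀ i j, v i = v j ↔ w i = w j
  adj_iff : ∀ w v, X w v ≠ 0 → ∀ i j, G.Adj (v i) (v j) ↔ H.Adj (w i) (w j)
  marginal : ∀ w v j, ∑ b, X w (Function.update v j b) = ∑ c, X (Function.update w j c) v

/-- Every vertex of a basal graph carries a label, so prescribing the labels leaves at most one
homomorphism. -/
theorem natCard_eq_ite_of_subsingleton {α : Type*} [Subsingleton α] {P : Prop} [Decidable P]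
    (h : Nonempty α ↔ P) : (Nat.card α : ℚ) = if P then 1 else 0 := by
  split_ifs with hP
  · obtain ⟨a⟩ := h.2 hP
    have : Unique α := uniqueOfSubsingleton a
    simp
  · have : IsEmpty α := not_nonempty_iff.1 (fun h' => hP (h.1 h'))
    simp

open Classical in
theorem homMatrix_identityGraph {V : Type*} {m : ℕ} (G : SimpleGraph V) (x y : Fin m → V) :
    (identityGraph m).homMatrix G x y = if x = y ∧ True then 1 else 0 := by
  have : Subsingleton {h : (identityGraph m).graph →g G //
      (∀ i, h ((identityGraph m).inLabel i) = x i) ∧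
        (∀ j, h ((identityGraph m).outLabel j) = y j)} := by
    refine ⟨fun h h' => Subtype.ext (RelHom.ext fun l => ?_)⟩
    exact (h.2.1 l).trans (h'.2.1 l).symm
  refine natCard_eq_ite_of_subsingleton ⟨?_, ?_⟩
  · rintro ⟨h⟩
    exact ⟨funext fun l => (h.2.1 l).symm.trans (h.2.2 l), trivial⟩
  · rintro ⟨rfl, -⟩
    exact ⟨⟨⟨x, fun h => h.elim⟩, fun _ => rfl, fun _ => rfl⟩⟩

open Classical in
theorem homMatrix_adjacencyGraph {V : Type*} {m : ℕ} (G : SimpleGraph V) {i j : Fin m}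
    (hij : i ≠ j) (x y : Fin m → V) :
    (adjacencyGraph i j).homMatrix G x y = if x = y ∧ G.Adj (y i) (y j) then 1 else 0 := by
  have : Subsingleton {h : (adjacencyGraph i j).graph →g G //
      (∀ l, h ((adjacencyGraph i j).inLabel l) = x l) ∧
        (∀ l, h ((adjacencyGraph i j).outLabel l) = y l)} := by
    refine ⟨fun h h' => Subtype.ext (RelHom.ext fun l => ?_)⟩
    exact (h.2.1 l).trans (h'.2.1 l).symm
  refine natCard_eq_ite_of_subsingleton ⟨?_, ?_⟩
  · rintro ⟨h⟩
    refine ⟨funext fun l => (h.2.1 l).symm.trans (h.2.2 l), ?_⟩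
    have h1 : (adjacencyGraph i j).graph.Adj i j := by
      change (SimpleGraph.fromEdgeSet {s(i, j)}).Adj i j
      simp [hij]
    have h2 := h.1.map_adj h1
    have hi := h.2.2 i
    have hj := h.2.2 j
    rw [← hi, ← hj]
    exact h2
  · rintro ⟨rfl, hadj⟩
    refine ⟨⟨⟨x, fun {a b} h => ?_⟩, fun _ => rfl, fun _ => rfl⟩⟩
    have hab : (a = i ∧ b = j) ∨ (a = j ∧ b = i) :=
      Sym2.eq_iff.1 ((SimpleGraph.fromEdgeSet_adj _).1 h).1
    change G.Adj (x a) (x b)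
    rcases hab with hab | hab
    · exact hab.1 ▸ hab.2 ▸ hadj
    · exact hab.1 ▸ hab.2 ▸ hadj.symm

open Classical in
theorem homMatrix_identificationGraph {V : Type*} {m : ℕ} (G : SimpleGraph V) {i j : Fin m}
    (hij : i ≠ j) (x y : Fin m → V) :
    (identificationGraph i j hij).homMatrix G x y = if x = y ∧ y i = y j then 1 else 0 := by
  have key : ∀ h : (identificationGraph i j hij).graph →g G,
      h ((identificationGraph i j hij).outLabel i) =
        h ((identificationGraph i j hij).outLabel j) := by
    intro h
    simp [identificationGraph, hij]
  have : Subsingleton {h : (identificationGraph i j hij).graph →g G //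
      (∀ l, h ((identificationGraph i j hij).inLabel l) = x l) ∧
        (∀ l, h ((identificationGraph i j hij).outLabel l) = y l)} := by
    refine ⟨fun h h' => Subtype.ext (RelHom.ext fun l => ?_)⟩
    have hl : (identificationGraph i j hij).inLabel l.1 = l := by
      exact dif_neg (c := l.1 = j) l.2
    have := (h.2.1 l.1).trans (h'.2.1 l.1).symm
    rwa [hl] at this
  refine natCard_eq_ite_of_subsingleton ⟨?_, ?_⟩
  · rintro ⟨h⟩
    refine ⟨funext fun l => (h.2.1 l).symm.trans (h.2.2 l), ?_⟩
    rw [← h.2.2 i, ← h.2.2 j, key]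
  · rintro ⟨rfl, hx⟩
    refine ⟨⟨⟨fun l => x l.1, fun h => h.elim⟩, fun l => ?_, fun l => ?_⟩⟩ <;>
    · change x (if h : l = j then (⟨i, hij⟩ : {l : Fin m // l ≠ j}) else ⟨l, h⟩).1 = x l
      split_ifs with hl
      · exact hl ▸ hx
      · rfl

open Classical in
theorem homMatrix_forgettingGraph {V : Type*} {m : ℕ} (G : SimpleGraph V) (i : Fin m)
    (x y : Fin m → V) :
    (forgettingGraph i).homMatrix G x y = if ∀ l, l ≠ i → x l = y l then 1 else 0 := by
  have : Subsingleton {h : (forgettingGraph i).graph →g G //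
      (∀ l, h ((forgettingGraph i).inLabel l) = x l) ∧
        (∀ l, h ((forgettingGraph i).outLabel l) = y l)} := by
    refine ⟨fun h h' => Subtype.ext (RelHom.ext fun l => ?_)⟩
    cases l with
    | none =>
      have := (h.2.2 i).trans (h'.2.2 i).symm
      simpa [forgettingGraph] using this
    | some l => exact (h.2.1 l).trans (h'.2.1 l).symm
  refine natCard_eq_ite_of_subsingleton ⟨?_, ?_⟩
  · rintro ⟨h⟩ l hl
    have h1 := h.2.1 l
    have h2 := h.2.2 l
    rw [← h1, ← h2]
    simp [forgettingGraph, hl]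
  · intro hx
    refine ⟨⟨⟨fun l => l.elim (y i) x, fun h => h.elim⟩, fun l => rfl, fun l => ?_⟩⟩
    change (if l = i then none else some l : Option (Fin m)).elim (y i) x = y l
    split_ifs with hl
    · exact hl ▸ rfl
    · exact hx l hl

open Classical in
theorem sum_ite_agree_off {V : Type*} [Fintype V] {m : ℕ} (f : (Fin m → V) → ℚ) (i : Fin m)
    (y : Fin m → V) :
    ∑ x, f x * (if ∀ l, l ≠ i → x l = y l then 1 else 0) = ∑ b, f (Function.update y i b) := by
  simp only [mul_ite, mul_one, mul_zero]
  rw [← Finset.sum_filter]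
  symm
  refine Finset.sum_nbij' (fun b => Function.update y i b) (fun x => x i) ?_ ?_ ?_ ?_ ?_
  · intro b _
    simp +contextual
  · simp
  · simp
  · intro x hx
    simp only [Finset.mem_filter, Finset.mem_univ, true_and] at hx
    funext l
    by_cases hl : l = i
    · subst hl; simp
    · simp [hl, hx l hl]
  · simp

/-- The two products multiply the entry at `(w, v)` by the indicator of `P v` and of `Q w`
respectively. -/
theorem commute_diagonal_iff {I J : Type*} [Fintype I] [Fintype J] (X : Matrix I J ℚ)
    (D : Matrix J J ℚ) (E : Matrix I I ℚ) (P : J → Prop) (Q : I → Prop)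
    [∀ x y : J, Decidable (x = y ∧ P y)] [∀ x y : I, Decidable (x = y ∧ Q y)]
    (hD : ∀ x y, D x y = if x = y ∧ P y then 1 else 0)
    (hE : ∀ x y, E x y = if x = y ∧ Q y then 1 else 0) :
    X * D = E * X ↔ ∀ w v, X w v ≠ 0 → (P v ↔ Q w) := by
  classical
  have h1 : ∀ w v, (X * D) w v = if P v then X w v else 0 := by
    intro w v
    rw [Matrix.mul_apply, Finset.sum_eq_single v]
    · simp [hD]
    · intro b _ hb
      simp [hD, hb]
    · simp
  have h2 : ∀ w v, (E * X) w v = if Q w then X w v else 0 := by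
    intro w v
    rw [Matrix.mul_apply, Finset.sum_eq_single w]
    · simp [hE]
    · intro b _ hb
      simp [hE, hb.symm]
    · simp
  constructor
  · intro h w v hX
    have := congrFun (congrFun h w) v
    rw [h1, h2] at this
    by_cases hp : P v <;> by_cases hq : Q w <;> simp_all
  · intro h
    ext w v
    rw [h1, h2]
    by_cases hX : X w v = 0
    · simp [hX]
    · simp [h w v hX]

theorem commute_forgettingGraph_iff {V W : Type*} [Fintype V] [Fintype W] {m : ℕ}
    (G : SimpleGraph V) (H : SimpleGraph W) (X : Matrix (Fin m → W) (Fin m → V) ℚ) (i : Fin m) :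
    X * (forgettingGraph i).homMatrix G = (forgettingGraph i).homMatrix H * X ↔
      ∀ w v, ∑ b, X w (Function.update v i b) = ∑ c, X (Function.update w i c) v := by
  classical
  rw [← Matrix.ext_iff]
  refine forall_congr' fun w => forall_congr' fun v => ?_
  rw [Matrix.mul_apply, Matrix.mul_apply]
  simp only [homMatrix_forgettingGraph]
  rw [sum_ite_agree_off (fun x => X w x) i v, ← sum_ite_agree_off (fun x => X x v) i w]
  have : ∀ x : Fin m → W, (∀ l, l ≠ i → w l = x l) ↔ (∀ l, l ≠ i → x l = w l) := fun x => by
    simp only [eq_comm]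
  simp only [this, mul_comm]

theorem isPWSolution_iff {V W : Type*} [Fintype V] [Fintype W] (k : ℕ) (G : SimpleGraph V)
    (H : SimpleGraph W) (X : Matrix (Fin (k + 1) → W) (Fin (k + 1) → V) ℚ) :
    IsPWSolution k G H X ↔ IsTupleCoupling (k + 1) G H X := by
  classical
  constructor
  · rintro ⟨⟨hr, hc⟩, hB⟩
    refine ⟨hr, hc, fun w v hX i j => ?_, fun w v hX i j => ?_, fun w v j => ?_⟩
    · by_cases hij : i = j
      · simp [hij]
      · exact (commute_diagonal_iff X _ _ _ _ (homMatrix_identificationGraph G hij)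
          (homMatrix_identificationGraph H hij)).1
          (hB _ (Or.inr (Or.inr (Or.inl ⟨i, j, hij, rfl⟩)))) w v hX
    · by_cases hij : i = j
      · simp [hij]
      · exact (commute_diagonal_iff X _ _ _ _ (homMatrix_adjacencyGraph G hij)
          (homMatrix_adjacencyGraph H hij)).1
          (hB _ (Or.inr (Or.inl ⟨i, j, hij, rfl⟩))) w v hX
    · exact (commute_forgettingGraph_iff G H X j).1
        (hB _ (Or.inr (Or.inr (Or.inr ⟨j, rfl⟩)))) w v
  · intro h
    refine ⟨⟨h.row_sum, h.col_sum⟩, ?_⟩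
    rintro B (rfl | ⟨i, j, hij, rfl⟩ | ⟨i, j, hij, rfl⟩ | ⟨i, rfl⟩)
    · exact (commute_diagonal_iff X _ _ _ _ (homMatrix_identityGraph G)
        (homMatrix_identityGraph H)).2 fun w v _ => Iff.rfl
    · exact (commute_diagonal_iff X _ _ _ _ (homMatrix_adjacencyGraph G hij)
        (homMatrix_adjacencyGraph H hij)).2 fun w v hX => h.adj_iff w v hX i j
    · exact (commute_diagonal_iff X _ _ _ _ (homMatrix_identificationGraph G hij)
        (homMatrix_identificationGraph H hij)).2 fun w v hX => h.eq_iff w v hX i j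
    · exact (commute_forgettingGraph_iff G H X i).2 fun w v => h.marginal w v i

/-! ### Eliminating variables along a solution of L_iso -/

/-- `f` and `g` depend only on the values on `A`, and they agree on every pair of maps whose graph
over `A` lies in the support of `Y`. -/
structure TransfersOn {U V W : Type*} [DecidableEq V] [DecidableEq W] (Y : Finset (W × V) → ℚ)
    (A : Finset U) (f : (U → V) → ℚ) (g : (U → W) → ℚ) : Prop where
  left_congr : ∀ h h' : U → V, (∀ u ∈ A, h u = h' u) → f h = f h'
  right_congr : ∀ h h' : U → W, (∀ u ∈ A, h u = h' u) → g h = g h'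
  eq_of_ne_zero : ∀ (h : U → V) (h' : U → W), Y (A.image fun u => (h' u, h u)) ≠ 0 → f h = g h'

theorem TransfersOn.mul {U V W : Type*} [DecidableEq V] [DecidableEq W]
    {Y : Finset (W × V) → ℚ} {A : Finset U} {f f' : (U → V) → ℚ} {g g' : (U → W) → ℚ}
    (h : TransfersOn Y A f g) (h' : TransfersOn Y A f' g') :
    TransfersOn Y A (f * f') (g * g') where
  left_congr a b hab := by simp [h.left_congr a b hab, h'.left_congr a b hab]
  right_congr a b hab := by simp [h.right_congr a b hab, h'.right_congr a b hab]
  eq_of_ne_zero a b hab := by simp [h.eq_of_ne_zero a b hab, h'.eq_of_ne_zero a b hab]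

/-- The average of `f` over all changes of its argument at `u`. -/
noncomputable def averageAt {U V : Type*} [DecidableEq U] [Fintype V] (u : U)
    (f : (U → V) → ℚ) (h : U → V) : ℚ :=
  (∑ b, f (Function.update h u b)) / Fintype.card V

theorem sum_sum_update {U V : Type*} [DecidableEq U] [Fintype U] [Fintype V] (u : U)
    (f : (U → V) → ℚ) :
    ∑ h, ∑ b, f (Function.update h u b) = Fintype.card V * ∑ h, f h := by
  -- Exchanging the value at `u` with the extra value `b` is a bijection of the index set.
  have hinv : Function.Involutive
      (fun p : (U → V) × V => (Function.update p.1 u p.2, p.1 u)) := by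
    rintro ⟨h, b⟩
    simp
  have h1 := Equiv.sum_comp hinv.toPerm (fun p : (U → V) × V => f p.1)
  rw [Fintype.sum_prod_type, Fintype.sum_prod_type] at h1
  simp only [Function.Involutive.coe_toPerm] at h1
  rw [h1, Finset.sum_comm]
  simp

/-- Averaging, rather than summing, keeps all functions on the full space of maps, so the total is
unchanged. The weight `P` stands for the bags that do not contain `u`. -/
theorem sum_mul_averageAt {U V : Type*} [DecidableEq U] [Fintype U] [Fintype V] (u : U)
    (P f : (U → V) → ℚ) (hP : ∀ h b, P (Function.update h u b) = P h) :
    ∑ h, P h * averageAt u f h = ∑ h, P h * f h := by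
  rcases isEmpty_or_nonempty V with hV | hV
  -- The average divides by zero here, but there are no maps to sum over.
  · have : IsEmpty (U → V) := ⟨fun h => hV.elim (h u)⟩
    simp
  · have hc : (Fintype.card V : ℚ) ≠ 0 := by simp
    have h1 := sum_sum_update u (fun h => P h * f h)
    simp only [hP] at h1
    simp only [averageAt, mul_div_assoc', ← Finset.sum_div, Finset.mul_sum]
    rw [h1, mul_div_cancel_left₀ _ hc]

section Liso

variable {U V W : Type*} [Fintype V] [Fintype W] [DecidableEq V] [DecidableEq W] {k : ℕ}
  {G : SimpleGraph V} {H : SimpleGraph W} {Y : Finset (W × V) → ℚ}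

theorem IsLisoSolution.card_eq (hY : IsLisoSolution k G H Y) :
    (Fintype.card V : ℚ) = Fintype.card W := by
  have h1 : ∑ w : W, ∑ v : V, Y (∅ ∪ {(w, v)}) = Fintype.card W := by
    rw [Finset.sum_congr rfl fun w _ => hY.continuity_left ∅ (by simp) w]
    simp [hY.empty_eq_one]
  have h2 : ∑ v : V, ∑ w : W, Y (∅ ∪ {(w, v)}) = Fintype.card V := by
    rw [Finset.sum_congr rfl fun v _ => hY.continuity_right ∅ (by simp) v]
    simp [hY.empty_eq_one]
  rw [← h1, ← h2, Finset.sum_comm]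

theorem IsLisoSolution.union_singleton_eq_zero (hY : IsLisoSolution k G H Y)
    (h0 : ∀ π : Finset (W × V), π.card ≤ k + 1 → 0 ≤ Y π) {π : Finset (W × V)} (hπ : π.card ≤ k)
    (hz : Y π = 0) (p : W × V) : Y (π ∪ {p}) = 0 := by
  have h1 := hY.continuity_left π hπ p.1
  rw [hz, Finset.sum_eq_zero_iff_of_nonneg] at h1
  · exact h1 p.2 (Finset.mem_univ _)
  · intro v _
    refine h0 _ ((Finset.card_union_le _ _).trans ?_)
    simpa using hπ

/-- Non-negative values summing to zero all vanish, so by continuity a zero propagates to each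
one-pair extension, hence to all larger sets in range. -/
theorem IsLisoSolution.eq_zero_of_subset (hY : IsLisoSolution k G H Y)
    (h0 : ∀ π : Finset (W × V), π.card ≤ k + 1 → 0 ≤ Y π) {σ π : Finset (W × V)} (hσ : σ ⊆ π)
    (hπ : π.card ≤ k + 1) (hz : Y σ = 0) : Y π = 0 := by
  have key : ∀ D : Finset (W × V), (σ ∪ D).card ≤ k + 1 → Y (σ ∪ D) = 0 := by
    intro D
    induction D using Finset.induction_on with
    | empty => intro _; simpa using hz
    | insert a D _ ih =>
      intro hc
      have he : σ ∪ insert a D = (σ ∪ D) ∪ {a} := by grind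
      by_cases ha : a ∈ σ ∪ D
      · have : σ ∪ insert a D = σ ∪ D := by grind
        rw [this] at hc ⊢
        exact ih hc
      · rw [he] at hc ⊢
        rw [Finset.card_union_of_disjoint (by simpa using ha), Finset.card_singleton] at hc
        exact hY.union_singleton_eq_zero h0 (by omega) (ih (by omega)) a
  have := key π (by rwa [Finset.union_eq_right.2 hσ])
  rwa [Finset.union_eq_right.2 hσ] at this

theorem TransfersOn.mono (hY : IsLisoSolution k G H Y)
    (h0 : ∀ π : Finset (W × V), π.card ≤ k + 1 → 0 ≤ Y π) {A B : Finset U} (hAB : A ⊆ B)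
    (hB : B.card ≤ k + 1) {f : (U → V) → ℚ} {g : (U → W) → ℚ} (h : TransfersOn Y A f g) :
    TransfersOn Y B f g where
  left_congr a b hab := h.left_congr a b fun u hu => hab u (hAB hu)
  right_congr a b hab := h.right_congr a b fun u hu => hab u (hAB hu)
  eq_of_ne_zero a b hab := h.eq_of_ne_zero a b fun hz =>
    hab (hY.eq_zero_of_subset h0 (Finset.image_subset_image hAB)
      (Finset.card_image_le.trans hB) hz)

/-- Expanding `Y π` by continuity, over `W` in the sum of `f` and over `V` in the sum of `g`, turns
both into double sums over one-pair extensions of `π`. These agree termwise, because `f` and `g`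
agree wherever the extension has nonzero `Y`. -/
theorem TransfersOn.averageAt [DecidableEq U] (hY : IsLisoSolution k G H Y) {A : Finset U} {u : U}
    (hu : u ∈ A) (hA : A.card ≤ k + 1) {f : (U → V) → ℚ} {g : (U → W) → ℚ}
    (h : TransfersOn Y A f g) : TransfersOn Y (A.erase u) (averageAt u f) (averageAt u g) where
  left_congr a b hab := by
    unfold _root_.averageAt
    congr 1
    refine Finset.sum_congr rfl fun x _ => h.left_congr _ _ fun y hy => ?_
    by_cases hyu : y = u
    · subst hyu; simp
    · simp [hyu, hab y (Finset.mem_erase.2 ⟨hyu, hy⟩)]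
  right_congr a b hab := by
    unfold _root_.averageAt
    congr 1
    refine Finset.sum_congr rfl fun x _ => h.right_congr _ _ fun y hy => ?_
    by_cases hyu : y = u
    · subst hyu; simp
    · simp [hyu, hab y (Finset.mem_erase.2 ⟨hyu, hy⟩)]
  eq_of_ne_zero a b hab := by
    set π := (A.erase u).image fun x => (b x, a x) with hπ
    have hcard : π.card ≤ k := by
      refine Finset.card_image_le.trans ?_
      rw [Finset.card_erase_of_mem hu]
      omega
    have himage : ∀ w v, (A.image fun x => (Function.update b u w x, Function.update a u v x)) =
        π ∪ {(w, v)} := by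
      intro w v
      rw [← Finset.insert_erase hu, Finset.image_insert, Finset.union_comm,
        ← Finset.insert_eq]
      congr 1
      · simp
      · refine Finset.image_congr fun x hx => ?_
        have : x ≠ u := (Finset.mem_erase.1 (Finset.mem_coe.1 hx)).1
        simp [this]
    have hpt : ∀ v w, f (Function.update a u v) * Y (π ∪ {(w, v)}) =
        g (Function.update b u w) * Y (π ∪ {(w, v)}) := by
      intro v w
      by_cases hz : Y (π ∪ {(w, v)}) = 0
      · rw [hz, mul_zero, mul_zero]
      · rw [h.eq_of_ne_zero (Function.update a u v) (Function.update b u w)]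
        rwa [himage]
    have hsum : (∑ v, f (Function.update a u v)) * Y π =
        (∑ w, g (Function.update b u w)) * Y π := by
      rw [Finset.sum_mul, Finset.sum_mul]
      calc ∑ v, f (Function.update a u v) * Y π
          = ∑ v, ∑ w, f (Function.update a u v) * Y (π ∪ {(w, v)}) := by
            refine Finset.sum_congr rfl fun v _ => ?_
            rw [← Finset.mul_sum, hY.continuity_right π hcard]
        _ = ∑ w, ∑ v, g (Function.update b u w) * Y (π ∪ {(w, v)}) := by
            rw [Finset.sum_comm]
            exact Finset.sum_congr rfl fun w _ => Finset.sum_congr rfl fun v _ => hpt v w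
        _ = ∑ w, g (Function.update b u w) * Y π := by
            refine Finset.sum_congr rfl fun w _ => ?_
            rw [← Finset.mul_sum, hY.continuity_left π hcard]
    unfold _root_.averageAt
    rw [mul_right_cancel₀ hab hsum, hY.card_eq]

/-- Summing out the variables in `B`. -/
theorem TransfersOn.exists_sdiff [DecidableEq U] [Fintype U] (hY : IsLisoSolution k G H Y)
    {A : Finset U} (hA : A.card ≤ k + 1) {f : (U → V) → ℚ} {g : (U → W) → ℚ}
    (h : TransfersOn Y A f g) (B : Finset U) (hB : B ⊆ A) :
    ∃ f' g', TransfersOn Y (A \ B) f' g' ∧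
      (∀ P : (U → V) → ℚ, (∀ u ∈ B, ∀ h b, P (Function.update h u b) = P h) →
        ∑ h, P h * f h = ∑ h, P h * f' h) ∧
      (∀ P : (U → W) → ℚ, (∀ u ∈ B, ∀ h b, P (Function.update h u b) = P h) →
        ∑ h, P h * g h = ∑ h, P h * g' h) := by
  induction B using Finset.induction_on with
  | empty => exact ⟨f, g, by simpa using h, fun _ _ => rfl, fun _ _ => rfl⟩
  | insert u B hu ih =>
    obtain ⟨f', g', h', hf, hg⟩ := ih ((Finset.subset_insert u B).trans hB)
    refine ⟨_root_.averageAt u f', _root_.averageAt u g', ?_, fun P hP => ?_, fun P hP => ?_⟩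
    · have := h'.averageAt hY (u := u)
        (Finset.mem_sdiff.2 ⟨hB (Finset.mem_insert_self _ _), hu⟩)
        ((Finset.card_le_card Finset.sdiff_subset).trans hA)
      rwa [Finset.sdiff_insert]
    · rw [sum_mul_averageAt u P f' (hP u (Finset.mem_insert_self _ _))]
      exact hf P fun x hx => hP x (Finset.mem_insert_of_mem hx)
    · rw [sum_mul_averageAt u P g' (hP u (Finset.mem_insert_self _ _))]
      exact hg P fun x hx => hP x (Finset.mem_insert_of_mem hx)

theorem TransfersOn.sum_eq [DecidableEq U] [Fintype U] (hY : IsLisoSolution k G H Y)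
    {A : Finset U} (hA : A.card ≤ k + 1) {f : (U → V) → ℚ} {g : (U → W) → ℚ}
    (h : TransfersOn Y A f g) : ∑ a, f a = ∑ b, g b := by
  obtain ⟨f', g', h', hf, hg⟩ := h.exists_sdiff hY hA A subset_rfl
  have hf1 := hf (fun _ => 1) fun _ _ _ _ => rfl
  have hg1 := hg (fun _ => 1) fun _ _ _ _ => rfl
  simp only [one_mul] at hf1 hg1
  rw [hf1, hg1]
  -- No variable is left, so the transfer condition is tested at `Y ∅ = 1` and both functions equal
  -- one constant.
  have hc : ∀ a b, f' a = g' b := fun a b => h'.eq_of_ne_zero a b (by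
    simp [hY.empty_eq_one])
  have hcard : Fintype.card V = Fintype.card W := by exact_mod_cast hY.card_eq
  have e : (U → V) ≃ (U → W) := Equiv.arrowCongr (Equiv.refl U) (Fintype.equivOfCardEq hcard)
  exact Fintype.sum_equiv e _ _ fun a => hc a _

end Liso

/-! ### Leaf elimination on tree decompositions -/

theorem SimpleGraph.Preconnected.exists_adj_of_ne {S : Type*} {T : SimpleGraph S} {A : Set S}
    (hA : (T.induce A).Preconnected) {s s' : S} (hs : s ∈ A) (hs' : s' ∈ A) (hne : s ≠ s') :
    ∃ t ∈ A, T.Adj s t := by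
  obtain ⟨p⟩ := hA ⟨s, hs⟩ ⟨s', hs'⟩
  cases p with
  | nil => exact (hne rfl).elim
  | cons hadj _ => exact ⟨_, Subtype.property _, hadj⟩

theorem prod_compl_singleton_mul {S : Type*} [Fintype S] [DecidableEq S] {s t : S} (hts : t ≠ s)
    [Fintype {x // x ∈ ({s}ᶜ : Set S)}] (φ : S → ℚ) (c : ℚ) :
    ∏ x : {x // x ∈ ({s}ᶜ : Set S)}, (φ x.1 * if x.1 = t then c else 1) =
      (∏ x ∈ Finset.univ.erase s, φ x) * c := by
  rw [← Finset.prod_subtype (p := (· ∈ ({s}ᶜ : Set S))) (Finset.univ.erase s) (by simp)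
    (fun x => φ x * if x = t then c else 1), Finset.prod_mul_distrib, Finset.prod_ite_eq']
  simp [hts]

/-- Sums over all maps of products of transferring weights on the bags of a tree decomposition
agree. -/
theorem IsLisoSolution.sum_prod_eq {V W : Type*} [Fintype V] [Fintype W] [DecidableEq V]
    [DecidableEq W] {k : ℕ} {G : SimpleGraph V} {H : SimpleGraph W} {Y : Finset (W × V) → ℚ}
    (hY : IsLisoSolution k G H Y) (h0 : ∀ π : Finset (W × V), π.card ≤ k + 1 → 0 ≤ Y π)
    {U : Type*} [DecidableEq U] [Fintype U] (n : ℕ) :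
    ∀ {S : Type} [Fintype S] (T : SimpleGraph S), T.IsTree → Fintype.card S = n →
    ∀ (bag : S → Finset U), (∀ s, (bag s).card ≤ k + 1) →
    (∀ u, (T.induce {s | u ∈ bag s}).Preconnected) →
    ∀ (f : S → (U → V) → ℚ) (g : S → (U → W) → ℚ), (∀ s, TransfersOn Y (bag s) (f s) (g s)) →
    ∑ a, ∏ s, f s a = ∑ b, ∏ s, g s b := by
  classical
  induction n with
  | zero =>
    intro S _ T hT hS
    have := hT.connected.nonempty
    simp at hS
  | succ n ih =>
    intro S _ T hT hS bag hcard hconn f g hfg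
    rcases subsingleton_or_nontrivial S with hsub | hnt
    · obtain ⟨s⟩ := hT.connected.nonempty
      have : Unique S := ⟨⟨s⟩, fun _ => Subsingleton.elim _ _⟩
      simp only [Fintype.prod_unique]
      exact (hfg _).sum_eq hY (hcard _)
    · obtain ⟨s, hs⟩ := hT.exists_vert_degree_one_of_nontrivial
      have hdel := hT.connected.induce_compl_singleton_of_degree_eq_one hs
      obtain ⟨t, hst, ht⟩ := SimpleGraph.degree_eq_one_iff_existsUnique_adj.1 hs
      -- A variable of the leaf bag that occurs in any other bag must occur in the bag of the unique
      -- neighbour `t`.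
      have hint : ∀ u s', s' ≠ s → u ∈ bag s → u ∈ bag s' → u ∈ bag t := by
        intro u s' hne hu hu'
        obtain ⟨t', ht', hadj⟩ := (hconn u).exists_adj_of_ne hu hu' hne.symm
        exact ht t' hadj ▸ ht'
      -- The variables private to the leaf are eliminated; what remains lives on `bag s ∩ bag t` and
      -- becomes an extra factor at `t`.
      obtain ⟨f', g', h', hf', hg'⟩ := (hfg s).exists_sdiff hY (hcard s) (bag s \ bag t)
        Finset.sdiff_subset
      have h'' : TransfersOn Y (bag t) f' g' :=
        h'.mono hY h0 (by intro x; simp) (hcard t)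
      have hts : t ≠ s := hst.ne'
      have hconn' : ∀ u, ((T.induce {s}ᶜ).induce {x | u ∈ bag x.1}).Preconnected := by
        intro u
        -- All neighbours of the leaf within the nodes containing `u` coincide, so no connection
        -- needs to pass through it.
        have h1 : ((T.induce {x | u ∈ bag x}).induce {y | y.1 ≠ s}).Preconnected := by
          refine (hconn u).induce_of_degree_eq_one fun v hv a ha b hb => ?_
          have hvs : v.1 = s := by simpa using hv
          have ha' : T.Adj v.1 a.1 := ha
          have hb' : T.Adj v.1 b.1 := hb
          rw [hvs] at ha' hb'
          exact Subtype.ext ((ht _ ha').trans (ht _ hb').symm)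
        let e : ((T.induce {x | u ∈ bag x}).induce {y | y.1 ≠ s}) →g
            ((T.induce {s}ᶜ).induce {x | u ∈ bag x.1}) :=
          ⟨fun y => ⟨⟨y.1.1, y.2⟩, y.1.2⟩, fun h => h⟩
        exact h1.map e fun y => ⟨⟨⟨y.1.1, y.2⟩, y.1.2⟩, rfl⟩
      have hmain := ih (T.induce {s}ᶜ) ⟨hdel, hT.isAcyclic.induce _⟩
        (by
          rw [← Nat.card_eq_fintype_card, Nat.card_coe_set_eq,
            Set.ncard_compl, Set.ncard_singleton, Nat.card_eq_fintype_card, hS, Nat.add_sub_cancel]) (fun x => bag x.1)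
        (fun x => hcard x.1) hconn' (fun x => f x.1 * if x.1 = t then f' else 1)
        (fun x => g x.1 * if x.1 = t then g' else 1) (fun x => by
          split_ifs with hx
          · exact (hfg x.1).mul (hx ▸ h'')
          · simpa using hfg x.1)
      have hL : ∀ a, ∏ x : {x // x ∈ ({s}ᶜ : Set S)}, (f x.1 * if x.1 = t then f' else 1) a =
          (∏ x ∈ Finset.univ.erase s, f x a) * f' a := fun a => by
        rw [← prod_compl_singleton_mul hts]
        exact Finset.prod_congr rfl fun x _ => by split_ifs <;> simp
      have hR : ∀ a, ∏ x : {x // x ∈ ({s}ᶜ : Set S)}, (g x.1 * if x.1 = t then g' else 1) a =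
          (∏ x ∈ Finset.univ.erase s, g x a) * g' a := fun a => by
        rw [← prod_compl_singleton_mul hts]
        exact Finset.prod_congr rfl fun x _ => by split_ifs <;> simp
      simp only [hL, hR] at hmain
      have hindep : ∀ u ∈ bag s \ bag t, ∀ x ∈ Finset.univ.erase s, u ∉ bag x := by
        intro u hu x hx hux
        rw [Finset.mem_sdiff] at hu
        exact hu.2 (hint u x (Finset.ne_of_mem_erase hx) hu.1 hux)
      rw [← hf' (fun a => ∏ x ∈ Finset.univ.erase s, f x a), ← hg'
        (fun a => ∏ x ∈ Finset.univ.erase s, g x a)] at hmain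
      · simp only [Finset.prod_erase_mul _ _ (Finset.mem_univ s)] at hmain
        exact hmain
      · intro u hu h b
        refine Finset.prod_congr rfl fun x hx => (hfg x).right_congr _ _ fun y hy => ?_
        exact Function.update_of_ne (fun hyu => hindep u hu x hx (by rwa [← hyu])) _ _
      · intro u hu h b
        refine Finset.prod_congr rfl fun x hx => (hfg x).left_congr _ _ fun y hy => ?_
        exact Function.update_of_ne (fun hyu => hindep u hu x hx (by rwa [← hyu])) _ _

-- Each edge of `F` lies in some bag, so being a homomorphism is a conjunction of conditions local
-- to the bags.
open Classical in
theorem homCount_eq_sum_prod {U V S : Type*} [Fintype U] [DecidableEq U] [Fintype V] [Fintype S]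
    {F : SimpleGraph U} {T : SimpleGraph S} (D : GraphDecomposition F T) (G : SimpleGraph V) :
    (homCount F G : ℚ) = ∑ a : U → V, ∏ s,
      if ∀ u ∈ D.bag s, ∀ v ∈ D.bag s, F.Adj u v → G.Adj (a u) (a v) then 1 else 0 := by
  have hprod : ∀ a : U → V, (∏ s, if ∀ u ∈ D.bag s, ∀ v ∈ D.bag s, F.Adj u v → G.Adj (a u) (a v)
      then (1 : ℚ) else 0) = if ∀ u v, F.Adj u v → G.Adj (a u) (a v) then 1 else 0 := by
    intro a
    by_cases h : ∀ u v, F.Adj u v → G.Adj (a u) (a v)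
    · rw [if_pos h]
      exact Finset.prod_eq_one fun s _ => if_pos fun u _ v _ huv => h u v huv
    · rw [if_neg h]
      push Not at h
      obtain ⟨u, v, huv, hn⟩ := h
      obtain ⟨s, hu, hv⟩ := D.edge_mem u v huv
      exact Finset.prod_eq_zero (Finset.mem_univ s) (if_neg fun h => hn (h u hu v hv huv))
  rw [Finset.sum_congr rfl fun a _ => hprod a, Finset.sum_boole, Nat.cast_inj,
    ← Fintype.card_subtype, ← Nat.card_eq_fintype_card]
  exact Nat.card_congr ⟨fun h => ⟨h, fun u v huv => h.map_adj huv⟩,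
    fun a => ⟨a.1, fun {u v} huv => a.2 u v huv⟩, fun _ => rfl, fun _ => rfl⟩

theorem IsLisoSolution.homIndistinguishableTreewidth {V W : Type*} [Fintype V] [Fintype W]
    [DecidableEq V] [DecidableEq W] {k : ℕ} {G : SimpleGraph V} {H : SimpleGraph W}
    {Y : Finset (W × V) → ℚ} (hY : IsLisoSolution k G H Y)
    (h0 : ∀ π : Finset (W × V), π.card ≤ k + 1 → 0 ≤ Y π) :
    HomIndistinguishableTreewidth k G H := by
  classical
  rintro U _ F ⟨S, _, T, D, hT, hD⟩
  have hQ : (homCount F G : ℚ) = homCount F H := by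
    rw [homCount_eq_sum_prod D G, homCount_eq_sum_prod D H]
    refine hY.sum_prod_eq h0 _ T hT rfl D.bag hD (fun u => (D.connected u).preconnected)
      (fun s a => if ∀ u ∈ D.bag s, ∀ v ∈ D.bag s, F.Adj u v → G.Adj (a u) (a v) then 1 else 0)
      (fun s a => if ∀ u ∈ D.bag s, ∀ v ∈ D.bag s, F.Adj u v → H.Adj (a u) (a v) then 1 else 0)
      fun s => ⟨fun a b hab => ?_, fun a b hab => ?_, fun a b hab => ?_⟩
    · refine if_congr ?_ rfl rfl
      refine forall₂_congr fun u hu => forall₂_congr fun v hv => ?_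
      rw [hab u hu, hab v hv]
    · refine if_congr ?_ rfl rfl
      refine forall₂_congr fun u hu => forall₂_congr fun v hv => ?_
      rw [hab u hu, hab v hv]
    -- This is where the vanishing of `Y` off partial isomorphisms enters: on the support, edges at
    -- the bag have the same images in `G` and `H`.
    · have hiso : IsPartialIso G H ((D.bag s).image fun u => (b u, a u)) := by
        by_contra hn
        exact hab (hY.eq_zero _ (Finset.card_image_le.trans (hD s)) hn)
      refine if_congr ?_ rfl rfl
      refine forall₂_congr fun u hu => forall₂_congr fun v hv => ?_
      rw [(hiso _ (Finset.mem_image_of_mem _ hu) _ (Finset.mem_image_of_mem _ hv)).2]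
  exact_mod_cast hQ

/-! ### From tuples to sets of pairs -/

/-- A function of tuples that is invariant under permutations and under overwriting a repeated entry
by another entry depends only on the set of entries. -/
theorem eq_of_range_eq {ι α β : Type*} [Fintype ι] [DecidableEq ι] (Z : (ι → α) → β)
    (hperm : ∀ p (σ : Equiv.Perm ι), Z (p ∘ σ) = Z p)
    (hmove : ∀ p i j l, i ≠ j → l ≠ j → p i = p j → Z (Function.update p j (p l)) = Z p)
    (p p' : ι → α) (h : Set.range p = Set.range p') : Z p = Z p' := by
  classical
  -- Induction on the number of positions where the tuples differ.
  induction hn : (Finset.univ.filter fun i => p i ≠ p' i).card using Nat.strong_induction_on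
    generalizing p with
  | _ n ih =>
  by_cases hD : ∃ i, p i ≠ p' i
  · obtain ⟨i, hi⟩ := hD
    obtain ⟨i₂, hi₂⟩ : p i ∈ Set.range p' := h ▸ Set.mem_range_self i
    have hne : i₂ ≠ i := fun he => hi (by rw [← hi₂, he])
    -- If `i₂` is already correct, then `p i` is repeated at `i₂`, so position `i` can be
    -- overwritten by its target value, found at `j`. Otherwise swapping `i` and `i₂` corrects `i₂`,
    -- and `i` was wrong anyway.
    by_cases hi₂D : p i₂ = p' i₂
    · obtain ⟨j, hj⟩ : p' i ∈ Set.range p := h ▸ Set.mem_range_self i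
      have hji : j ≠ i := fun he => hi (by rw [← hj, he])
      rw [← hmove p i₂ i j hne hji (hi₂D.trans hi₂)]
      refine ih _ ?_ _ ?_ rfl
      · rw [← hn]
        refine Finset.card_lt_card (Finset.ssubset_iff_of_subset ?_ |>.2 ⟨i, ?_, ?_⟩)
        · intro x hx
          by_cases hxi : x = i
          · subst hxi; simpa using hi
          · simpa [hxi] using hx
        · simpa using hi
        · simp [hj]
      · rw [← h]
        ext a
        constructor
        · rintro ⟨x, rfl⟩
          by_cases hxi : x = i
          · subst hxi; simp
          · simp [hxi]
        · rintro ⟨x, rfl⟩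
          by_cases hxi : x = i
          · subst hxi
            exact ⟨i₂, by simp [hne, hi₂D, hi₂]⟩
          · exact ⟨x, by simp [hxi]⟩
    · rw [← hperm p (Equiv.swap i i₂)]
      refine ih _ ?_ _ ?_ rfl
      · rw [← hn]
        refine Finset.card_lt_card (Finset.ssubset_iff_of_subset ?_ |>.2 ⟨i₂, ?_, ?_⟩)
        · intro x hx
          by_cases hxi : x = i
          · subst hxi; simpa using hi
          · by_cases hxi₂ : x = i₂
            · subst hxi₂; simpa using hi₂D
            · simpa [Equiv.swap_apply_of_ne_of_ne hxi hxi₂] using hx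
        · simpa using hi₂D
        · simp [hi₂]
      · rw [← h, (Equiv.swap i i₂).surjective.range_comp]
  · push Not at hD
    rw [funext hD]

section Symmetrize

variable {V W : Type*} [Fintype V] [Fintype W] {m : ℕ} {G : SimpleGraph V} {H : SimpleGraph W}
  {X : (Fin m → W) → (Fin m → V) → ℚ}

/-- The average of a matrix over all simultaneous permutations of the positions. -/
noncomputable def symmetrize {V W : Type*} {m : ℕ} (X : (Fin m → W) → (Fin m → V) → ℚ)
    (w : Fin m → W) (v : Fin m → V) : ℚ :=
  (∑ σ : Equiv.Perm (Fin m), X (w ∘ σ) (v ∘ σ)) / Fintype.card (Equiv.Perm (Fin m))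

theorem symmetrize_comp_perm {V W : Type*} {m : ℕ} (X : (Fin m → W) → (Fin m → V) → ℚ)
    (w : Fin m → W) (v : Fin m → V) (τ : Equiv.Perm (Fin m)) :
    symmetrize X (w ∘ τ) (v ∘ τ) = symmetrize X w v := by
  unfold symmetrize
  congr 1
  exact Fintype.sum_equiv (Equiv.mulLeft τ) _ _ fun σ => rfl

theorem exists_ne_zero_of_symmetrize_ne_zero {V W : Type*} {m : ℕ}
    {X : (Fin m → W) → (Fin m → V) → ℚ} {w : Fin m → W} {v : Fin m → V}
    (h : symmetrize X w v ≠ 0) : ∃ σ : Equiv.Perm (Fin m), X (w ∘ σ) (v ∘ σ) ≠ 0 := by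
  by_contra! hn
  exact h (by simp [symmetrize, hn])

theorem IsTupleCoupling.symmetrize (hX : IsTupleCoupling m G H X) :
    IsTupleCoupling m G H (symmetrize X) where
  row_sum w := by
    unfold _root_.symmetrize
    rw [← Finset.sum_div, Finset.sum_comm, div_eq_one_iff_eq (by simp)]
    have : ∀ σ : Equiv.Perm (Fin m), ∑ v : Fin m → V, X (w ∘ σ) (v ∘ σ) = 1 := fun σ => by
      rw [← hX.row_sum (w ∘ σ)]
      exact Fintype.sum_equiv (σ.symm.arrowCongr (Equiv.refl V)) _ _ fun v => rfl
    rw [Finset.sum_congr rfl fun σ _ => this σ]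
    simp
  col_sum v := by
    unfold _root_.symmetrize
    rw [← Finset.sum_div, Finset.sum_comm, div_eq_one_iff_eq (by simp)]
    have : ∀ σ : Equiv.Perm (Fin m), ∑ w : Fin m → W, X (w ∘ σ) (v ∘ σ) = 1 := fun σ => by
      rw [← hX.col_sum (v ∘ σ)]
      exact Fintype.sum_equiv (σ.symm.arrowCongr (Equiv.refl W)) _ _ fun w => rfl
    rw [Finset.sum_congr rfl fun σ _ => this σ]
    simp
  eq_iff w v h i j := by
    obtain ⟨σ, hσ⟩ := exists_ne_zero_of_symmetrize_ne_zero h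
    simpa using hX.eq_iff _ _ hσ (σ.symm i) (σ.symm j)
  adj_iff w v h i j := by
    obtain ⟨σ, hσ⟩ := exists_ne_zero_of_symmetrize_ne_zero h
    simpa using hX.adj_iff _ _ hσ (σ.symm i) (σ.symm j)
  marginal w v j := by
    unfold _root_.symmetrize
    rw [← Finset.sum_div, ← Finset.sum_div, Finset.sum_comm,
      Finset.sum_comm (s := Finset.univ (α := W))]
    congr 1
    refine Finset.sum_congr rfl fun σ _ => ?_
    simp only [Function.update_comp_equiv]
    exact hX.marginal _ _ _

/-- Since `w i = w j`, the support condition forces the new `j`-th entry to equal `v i`, and a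
single term survives. -/
theorem IsTupleCoupling.marginal_eq_of_eq (hX : IsTupleCoupling m G H X) {w : Fin m → W}
    {v : Fin m → V} {i j : Fin m} (hij : i ≠ j) (hw : w i = w j) (hv : v i = v j) :
    ∑ b, X w (Function.update v j b) = X w v := by
  rw [Finset.sum_eq_single (v j)]
  · simp
  · intro b _ hb
    by_contra hn
    have := (hX.eq_iff _ _ hn i j).2 hw
    simp [hij] at this
    exact hb (this.symm.trans hv)
  · simp

/-- The tuple matrix as a function of tuples of pairs. -/
def pairTuple {V W : Type*} {m : ℕ} (X : (Fin m → W) → (Fin m → V) → ℚ) (p : Fin m → W × V) : ℚ :=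
  X (fun i => (p i).1) (fun i => (p i).2)

theorem pairTuple_update {V W : Type*} {m : ℕ} (X : (Fin m → W) → (Fin m → V) → ℚ)
    (p : Fin m → W × V) (j : Fin m) (q : W × V) :
    pairTuple X (Function.update p j q) =
      X (Function.update (fun i => (p i).1) j q.1) (Function.update (fun i => (p i).2) j q.2) := by
  unfold pairTuple
  congr 1 <;>
  · funext i
    by_cases h : i = j
    · subst h; simp
    · simp [h]

/-- The marginal condition makes the sum independent of the entry `w` put at position `j`. At the
original entry only one term is nonzero. -/
theorem IsTupleCoupling.sum_pairTuple_update (hX : IsTupleCoupling m G H X) {p : Fin m → W × V}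
    {i j : Fin m} (hij : i ≠ j) (hp : p i = p j) (w : W) :
    ∑ v, pairTuple X (Function.update p j (w, v)) = pairTuple X p := by
  simp only [pairTuple_update]
  rw [hX.marginal]
  simp only [Function.update_idem]
  rw [← hX.marginal]
  exact hX.marginal_eq_of_eq hij (congrArg Prod.fst hp) (congrArg Prod.snd hp)

theorem IsTupleCoupling.sum_pairTuple_update' (hX : IsTupleCoupling m G H X) {p : Fin m → W × V}
    {i j : Fin m} (hij : i ≠ j) (hp : p i = p j) (v : V) :
    ∑ w, pairTuple X (Function.update p j (w, v)) = pairTuple X p := by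
  simp only [pairTuple_update]
  rw [← hX.marginal]
  simp only [Function.update_idem]
  exact hX.marginal_eq_of_eq hij (congrArg Prod.fst hp) (congrArg Prod.snd hp)

/-- Position `j` repeats `i` in one tuple and `l` in the other, so both values equal the same sum
over pairs at `j` with first coordinate `(p l).1`. -/
theorem IsTupleCoupling.pairTuple_update_eq (hX : IsTupleCoupling m G H X) (p : Fin m → W × V)
    (i j l : Fin m) (hij : i ≠ j) (hlj : l ≠ j) (hp : p i = p j) :
    pairTuple X (Function.update p j (p l)) = pairTuple X p := by
  rw [← hX.sum_pairTuple_update hij hp (p l).1]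
  rw [← hX.sum_pairTuple_update (p := Function.update p j (p l)) hlj (by simp [hlj]) (p l).1]
  simp only [Function.update_idem]

theorem IsTupleCoupling.symmetrize_eq_of_range_eq (hX : IsTupleCoupling m G H X)
    (p p' : Fin m → W × V) (h : Set.range p = Set.range p') :
    pairTuple (_root_.symmetrize X) p = pairTuple (_root_.symmetrize X) p' :=
  eq_of_range_eq _ (fun p σ => symmetrize_comp_perm X (fun i => (p i).1) (fun i => (p i).2) σ)
    hX.symmetrize.pairTuple_update_eq p p' h

open Classical in
/-- The function of sets of pairs induced by a function of tuples of pairs. -/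
noncomputable def ofTuples {α : Type*} {m : ℕ} (Z : (Fin m → α) → ℚ) (π : Finset α) : ℚ :=
  -- For positive `m` no tuple has empty range, so the value 1 at `∅` is set by hand; for sets of
  -- more than `m` elements the value is immaterial.
  if h : ∃ p : Fin m → α, Set.range p = π then Z h.choose else if π = ∅ then 1 else 0

theorem ofTuples_eq {α : Type*} {m : ℕ} {Z : (Fin m → α) → ℚ}
    (hZ : ∀ p p', Set.range p = Set.range p' → Z p = Z p') (p : Fin m → α) (π : Finset α)
    (hp : Set.range p = π) : ofTuples Z π = Z p := by
  have h : ∃ p : Fin m → α, Set.range p = π := ⟨p, hp⟩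
  rw [ofTuples, dif_pos h]
  exact hZ _ _ (h.choose_spec.trans hp.symm)

theorem Finset.exists_fin_range_eq {α : Type*} {m : ℕ} {π : Finset α} (hne : π.Nonempty)
    (hc : π.card ≤ m) : ∃ p : Fin m → α, Set.range p = π := by
  have : Nonempty π := hne.to_subtype
  obtain ⟨f, hf⟩ : ∃ f : Fin m → π, Function.Surjective f := by
    obtain ⟨e⟩ := Function.Embedding.nonempty_of_card_le (α := π) (β := Fin m) (by simpa using hc)
    exact ⟨Function.invFun e, Function.invFun_surjective e.injective⟩
  exact ⟨fun i => f i, by rw [← Function.comp_def, hf.range_comp]; simp⟩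

theorem IsTupleCoupling.isLisoSolution [DecidableEq V] [DecidableEq W] {k : ℕ}
    {X : (Fin (k + 1) → W) → (Fin (k + 1) → V) → ℚ} (hX : IsTupleCoupling (k + 1) G H X) :
    IsLisoSolution k G H (ofTuples (pairTuple (_root_.symmetrize X))) := by
  have hZ := hX.symmetrize_eq_of_range_eq
  have hS := hX.symmetrize
  have hempty : ofTuples (pairTuple (_root_.symmetrize X)) ∅ = 1 := by
    rw [ofTuples, dif_neg, if_pos rfl]
    rintro ⟨p, hp⟩
    exact (hp ▸ Set.mem_range_self (0 : Fin (k + 1)) : p 0 ∈ ((∅ : Finset (W × V)) : Set (W × V)))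
      |> Finset.notMem_empty _
  -- Having at most `k` elements, `π` is listed by a (k+1)-tuple with a repetition; the redundant
  -- position `j` can then take a new pair `q` without losing any element.
  have hdup : ∀ π : Finset (W × V), π.card ≤ k → π.Nonempty → ∃ p : Fin (k + 1) → W × V,
      ∃ i j, i ≠ j ∧ p i = p j ∧ Set.range p = π ∧
        ∀ q, Set.range (Function.update p j q) = (π ∪ {q} : Finset (W × V)) := by
    intro π hπ hne
    obtain ⟨p, hp⟩ := Finset.exists_fin_range_eq hne (hπ.trans (Nat.le_succ k))
    have hninj : ¬ Function.Injective p := by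
      intro hinj
      have h1 := Set.ncard_range_of_injective hinj
      rw [hp, Set.ncard_coe_finset, Nat.card_eq_fintype_card, Fintype.card_fin] at h1
      omega
    rw [Function.Injective] at hninj
    push Not at hninj
    obtain ⟨i, j, hpij, hij⟩ := hninj
    refine ⟨p, i, j, hij, hpij, hp, fun q => ?_⟩
    rw [Finset.coe_union, ← hp]
    ext a
    constructor
    · rintro ⟨x, rfl⟩
      by_cases hx : x = j
      · subst hx; simp
      · simp [hx]
    · rintro (⟨x, rfl⟩ | ha)
      · by_cases hx : x = j
        · subst hx
          exact ⟨i, by simp [hij, hpij]⟩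
        · exact ⟨x, by simp [hx]⟩
      · exact ⟨j, by simpa using (Finset.mem_singleton.1 ha).symm⟩
  have hconst : ∀ q : W × V, ofTuples (pairTuple (_root_.symmetrize X)) (∅ ∪ {q}) =
      _root_.symmetrize X (fun _ => q.1) (fun _ => q.2) := fun q => by
    rw [ofTuples_eq hZ (fun _ => q) _ (by simp)]
    rfl
  refine ⟨fun π hπ w => ?_, fun π hπ v => ?_, hempty, fun π hπ hn => ?_⟩
  · rcases π.eq_empty_or_nonempty with rfl | hne
    -- The row of a constant tuple is supported on constant tuples, so its sum is the required sum
    -- over singletons.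
    · rw [hempty, ← hS.row_sum (fun _ => w)]
      simp only [hconst]
      refine Finset.sum_of_injOn (fun v _ => v) ?_ ?_ ?_ ?_
      · exact fun a _ b _ hab => congrFun hab 0
      · simp
      · intro v _ hv
        by_contra hn
        refine hv ⟨v 0, by simp, funext fun i => ?_⟩
        exact (hS.eq_iff _ _ hn 0 i).2 rfl
      · simp
    · obtain ⟨p, i, j, hij, hpij, hp, hq⟩ := hdup π hπ hne
      rw [ofTuples_eq hZ p π hp, ← hS.sum_pairTuple_update hij hpij w]
      exact Finset.sum_congr rfl fun v _ => ofTuples_eq hZ _ _ (hq _)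
  · rcases π.eq_empty_or_nonempty with rfl | hne
    · rw [hempty, ← hS.col_sum (fun _ => v)]
      simp only [hconst]
      refine Finset.sum_of_injOn (fun w _ => w) ?_ ?_ ?_ ?_
      · exact fun a _ b _ hab => congrFun hab 0
      · simp
      · intro w _ hw
        by_contra hn
        refine hw ⟨w 0, by simp, funext fun i => ?_⟩
        exact (hS.eq_iff _ _ hn 0 i).1 rfl
      · simp
    · obtain ⟨p, i, j, hij, hpij, hp, hq⟩ := hdup π hπ hne
      rw [ofTuples_eq hZ p π hp, ← hS.sum_pairTuple_update' hij hpij v]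
      exact Finset.sum_congr rfl fun w _ => ofTuples_eq hZ _ _ (hq _)
  · rcases π.eq_empty_or_nonempty with rfl | hne
    · exact (hn fun p hp => by simp at hp).elim
    · obtain ⟨p, hp⟩ := Finset.exists_fin_range_eq hne hπ
      rw [ofTuples_eq hZ p π hp]
      by_contra hX0
      refine hn fun a ha b hb => ?_
      rw [← Finset.mem_coe, ← hp] at ha hb
      obtain ⟨i, rfl⟩ := ha
      obtain ⟨j, rfl⟩ := hb
      exact ⟨hS.eq_iff _ _ hX0 i j, hS.adj_iff _ _ hX0 i j⟩

theorem ofTuples_nonneg {α : Type*} {m : ℕ} {Z : (Fin m → α) → ℚ} (hZ : ∀ p, 0 ≤ Z p)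
    (π : Finset α) : 0 ≤ ofTuples Z π := by
  unfold ofTuples
  split_ifs
  · exact hZ _
  · exact zero_le_one
  · exact le_rfl

theorem symmetrize_nonneg {V W : Type*} {m : ℕ} {X : (Fin m → W) → (Fin m → V) → ℚ}
    (hX : ∀ w v, 0 ≤ X w v) (w : Fin m → W) (v : Fin m → V) : 0 ≤ symmetrize X w v :=
  div_nonneg (Finset.sum_nonneg fun _ _ => hX _ _) (Nat.cast_nonneg _)

end Symmetrize

/-! ### Tree queries and their counts -/

theorem SimpleGraph.IsTree.sum_sup_edge {S S' : Type*} [Finite S] [Finite S'] {T : SimpleGraph S}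
    {T' : SimpleGraph S'} (hT : T.IsTree) (hT' : T'.IsTree) (s : S) (s' : S') :
    ((T ⊕g T') ⊔ SimpleGraph.edge (.inl s) (.inr s')).IsTree := by
  rw [SimpleGraph.isTree_iff_connected_and_card] at hT hT' ⊢
  refine ⟨hT.1.sum_sup_edge hT'.1, ?_⟩
  have hnm : s(Sum.inl s, Sum.inr s') ∉ (T ⊕g T').edgeSet := by simp
  have hedge : (SimpleGraph.edge (Sum.inl s : S ⊕ S') (Sum.inr s')).edgeSet =
      {s(Sum.inl s, Sum.inr s')} := by
    simp [SimpleGraph.edge]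
  rw [SimpleGraph.edgeSet_sup, hedge, Nat.card_coe_set_eq,
    Set.union_singleton, Set.ncard_insert_of_notMem hnm (Set.toFinite _), ← Nat.card_coe_set_eq,
    Nat.card_congr SimpleGraph.edgeSetSumEquiv, Nat.card_sum, Nat.card_sum]
  omega

/-- A tree of `m`-tuples of variables: `same` identifies variables at equal or adjacent nodes, and
`edge` requires adjacency of two variables at the same node. -/
structure TreeQuery (m : ℕ) where
  Node : Type
  [fintypeNode : Fintype Node]
  tree : SimpleGraph Node
  isTree : tree.IsTree
  root : Node
  same : Node × Fin m → Node × Fin m → Prop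
  same_adj : ∀ a b, same a b → a.1 = b.1 ∨ tree.Adj a.1 b.1
  edge : Node → Fin m → Fin m → Prop

namespace TreeQuery

attribute [instance] TreeQuery.fintypeNode

variable {m : ℕ}

/-- The assignments of vertices to the variables that satisfy all constraints. -/
def IsMatch {V : Type*} (Q : TreeQuery m) (G : SimpleGraph V) (h : Q.Node × Fin m → V) : Prop :=
  (∀ a b, Q.same a b → h a = h b) ∧ ∀ s i j, Q.edge s i j → G.Adj (h (s, i)) (h (s, j))

open Classical in
/-- The number of matches with prescribed values at the root. -/
noncomputable def value {V : Type*} [Fintype V] (Q : TreeQuery m) (G : SimpleGraph V)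
    (x : Fin m → V) : ℚ :=
  ∑ h : Q.Node × Fin m → V, if Q.IsMatch G h ∧ x = (fun i => h (Q.root, i)) then 1 else 0

open Classical in
theorem sum_value {V : Type*} [Fintype V] (Q : TreeQuery m) (G : SimpleGraph V)
    (P : (Fin m → V) → Prop) :
    (∑ x, if P x then Q.value G x else 0) =
      ∑ h : Q.Node × Fin m → V, if Q.IsMatch G h ∧ P (fun i => h (Q.root, i)) then 1 else 0 := by
  have h1 : ∀ x, (if P x then Q.value G x else 0) = ∑ h : Q.Node × Fin m → V,
      if x = (fun i => h (Q.root, i)) then (if Q.IsMatch G h ∧ P x then 1 else 0) else 0 := by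
    intro x
    rw [value]
    split_ifs with hP
    · refine Finset.sum_congr rfl fun h _ => ?_
      by_cases hx : x = fun i => h (Q.root, i)
      · simp [← hx, hP]
      · simp [hx]
    · simp [hP]
  simp only [h1]
  rw [Finset.sum_comm]
  refine Finset.sum_congr rfl fun h _ => ?_
  rw [Finset.sum_ite_eq' Finset.univ (fun i => h (Q.root, i))]
  simp

/-- The graph obtained by identifying variables according to `same`. -/
def graph (Q : TreeQuery m) : SimpleGraph (Quot Q.same) :=
  SimpleGraph.fromRel fun a b =>
    ∃ s i j, Q.edge s i j ∧ Quot.mk Q.same (s, i) = a ∧ Quot.mk Q.same (s, j) = b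

/-- Some edge constraint concerns two identified variables. -/
def HasLoop (Q : TreeQuery m) : Prop :=
  ∃ s i j, Q.edge s i j ∧ Quot.mk Q.same (s, i) = Quot.mk Q.same (s, j)

theorem not_isMatch_of_hasLoop {V : Type*} {Q : TreeQuery m} (hQ : Q.HasLoop) (G : SimpleGraph V)
    (h : Q.Node × Fin m → V) : ¬ Q.IsMatch G h := by
  rintro ⟨h1, h2⟩
  obtain ⟨s, i, j, he, heq⟩ := hQ
  have h3 : h (s, i) = h (s, j) := congrArg (Quot.lift h h1) heq
  exact (h2 s i j he).ne h3

/-- Matches are homomorphisms from the associated graph. -/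
def matchEquiv {V : Type*} {Q : TreeQuery m} (hQ : ¬ Q.HasLoop) (G : SimpleGraph V) :
    {h : Q.Node × Fin m → V // Q.IsMatch G h} ≃ (Q.graph →g G) where
  toFun h := ⟨Quot.lift h.1 h.2.1, by
    intro a b hab
    obtain ⟨-, ⟨s, i, j, he, rfl, rfl⟩ | ⟨s, i, j, he, rfl, rfl⟩⟩ :=
      (SimpleGraph.fromRel_adj _ _ _).1 hab
    · exact h.2.2 s i j he
    · exact (h.2.2 s i j he).symm⟩
  invFun f := ⟨fun a => f (Quot.mk _ a), fun a b hab => congrArg f (Quot.sound hab),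
    fun s i j he => f.map_adj ((SimpleGraph.fromRel_adj _ _ _).2
      ⟨fun heq => hQ ⟨s, i, j, he, heq⟩, Or.inl ⟨s, i, j, he, rfl, rfl⟩⟩)⟩
  left_inv _ := rfl
  right_inv f := RelHom.ext fun a => Quot.inductionOn a fun _ => rfl

/-- The tree of the query is itself a decomposition: the bag of a node holds the classes of its `k +
1` variables. -/
theorem treewidthAtMost_graph {k : ℕ} (Q : TreeQuery (k + 1)) : TreewidthAtMost Q.graph k := by
  classical
  let bag : Q.Node → Finset (Quot Q.same) := fun s => Finset.univ.image fun i => Quot.mk _ (s, i)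
  have hmem : ∀ a : Q.Node × Fin (k + 1), Quot.mk Q.same a ∈ bag a.1 := fun a =>
    Finset.mem_image_of_mem _ (Finset.mem_univ a.2)
  refine ⟨Q.Node, inferInstance, Q.tree, ⟨bag, ?_, ?_, ?_⟩, Q.isTree, ?_⟩
  · exact fun u => Quot.inductionOn u fun a => ⟨a.1, hmem a⟩
  · intro u v huv
    obtain ⟨-, ⟨s, i, j, he, rfl, rfl⟩ | ⟨s, i, j, he, rfl, rfl⟩⟩ :=
      (SimpleGraph.fromRel_adj _ _ _).1 huv
    · exact ⟨s, hmem (s, i), hmem (s, j)⟩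
    · exact ⟨s, hmem (s, j), hmem (s, i)⟩
  · intro u
    -- Each step of a chain of identifications stays at a node or crosses a tree edge, and every
    -- node visited has `u` in its bag.
    have key : ∀ a b, Relation.EqvGen Q.same a b → ∀ (ha : u ∈ bag a.1) (hb : u ∈ bag b.1),
        Quot.mk Q.same a = u →
        (Q.tree.induce {s | u ∈ bag s}).Reachable ⟨a.1, ha⟩ ⟨b.1, hb⟩ := by
      intro a b hab
      induction hab with
      | rel a b hab =>
        intro ha hb _
        rcases Q.same_adj a b hab with h | h
        · have : (⟨a.1, ha⟩ : {s | u ∈ bag s}) = ⟨b.1, hb⟩ := Subtype.ext h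
          rw [this]
        · exact SimpleGraph.Adj.reachable h
      | refl a => intro _ _ _; exact SimpleGraph.Reachable.refl _
      | symm a b hab ih =>
        intro ha hb hu
        exact (ih hb ha ((Quot.eqvGen_sound hab).trans hu)).symm
      | trans a b c hab hbc ih ih' =>
        intro ha hc hu
        have hub : Quot.mk Q.same b = u := (Quot.eqvGen_sound hab).symm.trans hu
        have hb : u ∈ bag b.1 := hub ▸ hmem b
        exact (ih ha hb hu).trans (ih' hb hc hub)
    have hne : ∃ s, u ∈ bag s := Quot.inductionOn u fun a => ⟨a.1, hmem a⟩
    obtain ⟨s₀, hs₀⟩ := hne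
    refine (SimpleGraph.connected_iff _).2 ⟨?_, ⟨⟨s₀, hs₀⟩⟩⟩
    rintro ⟨s, hs⟩ ⟨t, ht⟩
    obtain ⟨i, -, hi⟩ := Finset.mem_image.1 (show u ∈ bag s from hs)
    obtain ⟨j, -, hj⟩ := Finset.mem_image.1 (show u ∈ bag t from ht)
    exact key (s, i) (t, j) (Quot.eqvGen_exact (hi.trans hj.symm)) hs ht hi
  · intro s
    exact Finset.card_image_le.trans (by simp)

theorem sum_value_eq {V W : Type*} [Fintype V] [Fintype W] {k : ℕ} {G : SimpleGraph V}
    {H : SimpleGraph W} (hGH : HomIndistinguishableTreewidth k G H) (Q : TreeQuery (k + 1)) :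
    ∑ x, Q.value G x = ∑ x, Q.value H x := by
  classical
  have hG := Q.sum_value G fun _ => True
  have hH := Q.sum_value H fun _ => True
  simp only [if_true, and_true] at hG hH
  rw [hG, hH]
  -- The simple graph `Q.graph` forgets loops, so a query with a loop is treated apart: it has no
  -- match in either graph.
  by_cases hQ : Q.HasLoop
  · simp [not_isMatch_of_hasLoop hQ]
  · have : Fintype (Quot Q.same) := Fintype.ofFinite _
    have h1 := hGH _ Q.graph Q.treewidthAtMost_graph
    unfold homCount at h1
    rw [← Nat.card_congr (matchEquiv hQ G), ← Nat.card_congr (matchEquiv hQ H),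
      Nat.card_eq_fintype_card, Nat.card_eq_fintype_card, Fintype.card_subtype,
      Fintype.card_subtype] at h1
    rw [Finset.sum_boole, Finset.sum_boole, h1]

/-- A single node with given constraints. -/
def single (same edge : Fin m → Fin m → Prop) : TreeQuery m where
  Node := Unit
  tree := ⊥
  isTree := SimpleGraph.IsTree.of_subsingleton
  root := ()
  same a b := same a.2 b.2
  same_adj _ _ _ := Or.inl rfl
  edge _ := edge

open Classical in
theorem value_single {V : Type*} [Fintype V] (same edge : Fin m → Fin m → Prop)
    (G : SimpleGraph V) (x : Fin m → V) : (single same edge).value G x =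
      if (∀ i j, same i j → x i = x j) ∧ ∀ i j, edge i j → G.Adj (x i) (x j) then 1 else 0 := by
  unfold value
  refine (Finset.sum_eq_single (fun a : (single same edge).Node × Fin m => x a.2) ?_ ?_).trans ?_
  · intro h _ hne
    refine if_neg ?_
    rintro ⟨-, rfl⟩
    exact hne rfl
  · exact fun h => (h (Finset.mem_univ _)).elim
  · refine if_congr ?_ rfl rfl
    constructor
    · rintro ⟨⟨h1, h2⟩, -⟩
      exact ⟨fun i j hij => h1 ((), i) ((), j) hij, fun i j hij => h2 () i j hij⟩
    · rintro ⟨h1, h2⟩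
      exact ⟨⟨fun a b hab => h1 a.2 b.2 hab, fun _ i j hij => h2 i j hij⟩, rfl⟩

/-- The query `Q'` is attached below `Q`, and the root variables in `L` are identified. -/
def attach (L : Set (Fin m)) (Q Q' : TreeQuery m) : TreeQuery m where
  Node := Q.Node ⊕ Q'.Node
  tree := (Q.tree ⊕g Q'.tree) ⊔ SimpleGraph.edge (.inl Q.root) (.inr Q'.root)
  isTree := Q.isTree.sum_sup_edge Q'.isTree _ _
  root := .inl Q.root
  same a b := (∃ c d, Q.same c d ∧ a = (.inl c.1, c.2) ∧ b = (.inl d.1, d.2)) ∨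
    (∃ c d, Q'.same c d ∧ a = (.inr c.1, c.2) ∧ b = (.inr d.1, d.2)) ∨
    ∃ i ∈ L, a = (.inl Q.root, i) ∧ b = (.inr Q'.root, i)
  same_adj := by
    rintro a b (⟨c, d, h, rfl, rfl⟩ | ⟨c, d, h, rfl, rfl⟩ | ⟨i, -, rfl, rfl⟩)
    · exact (Q.same_adj c d h).imp (congrArg Sum.inl) fun h' => Or.inl h'
    · exact (Q'.same_adj c d h).imp (congrArg Sum.inr) fun h' => Or.inl h'
    · exact Or.inr (Or.inr (by simp [SimpleGraph.edge_adj]))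
  edge := Sum.elim Q.edge Q'.edge

theorem isMatch_attach_iff {V : Type*} (L : Set (Fin m)) (Q Q' : TreeQuery m) (G : SimpleGraph V)
    (h : (Q.Node ⊕ Q'.Node) × Fin m → V) : (attach L Q Q').IsMatch G h ↔
      (Q.IsMatch G fun a => h (.inl a.1, a.2)) ∧ (Q'.IsMatch G fun a => h (.inr a.1, a.2)) ∧
        ∀ i ∈ L, h (.inl Q.root, i) = h (.inr Q'.root, i) := by
  constructor
  · rintro ⟨h1, h2⟩
    exact ⟨⟨fun c d hcd => h1 _ _ (Or.inl ⟨c, d, hcd, rfl, rfl⟩), fun s => h2 (.inl s)⟩,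
      ⟨fun c d hcd => h1 _ _ (Or.inr (Or.inl ⟨c, d, hcd, rfl, rfl⟩)), fun s => h2 (.inr s)⟩,
      fun i hi => h1 _ _ (Or.inr (Or.inr ⟨i, hi, rfl, rfl⟩))⟩
  · rintro ⟨⟨h1, h2⟩, ⟨h1', h2'⟩, h3⟩
    refine ⟨?_, ?_⟩
    · rintro a b (⟨c, d, h, rfl, rfl⟩ | ⟨c, d, h, rfl, rfl⟩ | ⟨i, hi, rfl, rfl⟩)
      · exact h1 c d h
      · exact h1' c d h
      · exact h3 i hi
    · rintro (s | s) i j hij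
      · exact h2 s i j hij
      · exact h2' s i j hij

-- A match of the glued query is a pair of matches agreeing on `L` at the roots. For `L` everything
-- this yields products, for `L` missing one position a summation.
open Classical in
theorem value_attach {V : Type*} [Fintype V] (L : Set (Fin m)) (Q Q' : TreeQuery m)
    (G : SimpleGraph V) (x : Fin m → V) : (attach L Q Q').value G x =
      Q.value G x * ∑ y, if ∀ i ∈ L, x i = y i then Q'.value G y else 0 := by
  have h0 : (∑ y, if ∀ i ∈ L, x i = y i then Q'.value G y else 0) = ∑ h : Q'.Node × Fin m → V,
      if Q'.IsMatch G h ∧ ∀ i ∈ L, x i = h (Q'.root, i) then 1 else 0 := by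
    convert Q'.sum_value G fun y => ∀ i ∈ L, x i = y i
  rw [h0]
  let e : ((attach L Q Q').Node × Fin m → V) ≃ (Q.Node × Fin m → V) × (Q'.Node × Fin m → V) :=
    ((Equiv.sumProdDistrib _ _ _).arrowCongr (Equiv.refl V)).trans
      (Equiv.sumArrowEquivProdArrow _ _ _)
  have h1 : (attach L Q Q').value G x = ∑ p : (Q.Node × Fin m → V) × (Q'.Node × Fin m → V),
      (if Q.IsMatch G p.1 ∧ x = (fun i => p.1 (Q.root, i)) then 1 else 0) *
        (if Q'.IsMatch G p.2 ∧ ∀ i ∈ L, x i = p.2 (Q'.root, i) then 1 else 0) := by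
    unfold value
    refine Fintype.sum_equiv e _ _ fun h => ?_
    rw [ite_zero_mul_ite_zero, mul_one]
    refine if_congr ?_ rfl rfl
    refine (and_congr_left' (isMatch_attach_iff L Q Q' G h)).trans ?_
    change (_ ∧ x = fun i => h (.inl Q.root, i)) ↔ ((Q.IsMatch G fun a => h (.inl a.1, a.2)) ∧ x = fun i => h (.inl Q.root, i)) ∧
      (Q'.IsMatch G fun a => h (.inr a.1, a.2)) ∧ ∀ i ∈ L, x i = h (.inr Q'.root, i)
    constructor
    · rintro ⟨⟨hm, hm', hL⟩, hx⟩
      exact ⟨⟨hm, hx⟩, hm', fun i hi => (congrFun hx i).trans (hL i hi)⟩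
    · rintro ⟨⟨hm, hx⟩, hm', hL⟩
      exact ⟨⟨hm, hm', fun i hi => (congrFun hx i).symm.trans (hL i hi)⟩, hx⟩
  rw [h1, Fintype.sum_prod_type, value, Finset.sum_mul]
  simp only [Finset.mul_sum]

end TreeQuery

/-! ### Interpolating indicators of indistinguishability classes -/

section Separation

variable {Ω : Type*}

/-- Two points that are not distinguished by the functions in `M`. -/
def Indistinguishable (M : Submonoid (Ω → ℚ)) (a b : Ω) : Prop := ∀ f ∈ M, f a = f b

theorem Indistinguishable.symm {M : Submonoid (Ω → ℚ)} {a b : Ω} (h : Indistinguishable M a b) :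
    Indistinguishable M b a := fun f hf => (h f hf).symm

theorem Indistinguishable.trans {M : Submonoid (Ω → ℚ)} {a b c : Ω}
    (h : Indistinguishable M a b) (h' : Indistinguishable M b c) : Indistinguishable M a c :=
  fun f hf => (h f hf).trans (h' f hf)

theorem Indistinguishable.eq_of_mem_span {M : Submonoid (Ω → ℚ)} {a b : Ω}
    (h : Indistinguishable M a b) {f : Ω → ℚ} (hf : f ∈ Submodule.span ℚ (M : Set (Ω → ℚ))) :
    f a = f b := by
  induction hf using Submodule.span_induction with
  | mem f hf => exact h f hf
  | zero => rfl
  | add f g _ _ hf hg => simp [hf, hg]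
  | smul c f _ hf => simp [hf]

open Classical in
/-- The indicator functions of the classes are linear combinations of functions in `M`. -/
theorem indicator_mem_span [Fintype Ω] (M : Submonoid (Ω → ℚ)) (a : Ω) :
    (fun b => if Indistinguishable M a b then 1 else 0) ∈
      Submodule.span ℚ (M : Set (Ω → ℚ)) := by
  -- Since `M` is closed under multiplication, its span is already an algebra.
  have hspan : Subalgebra.toSubmodule (Algebra.adjoin ℚ (M : Set (Ω → ℚ))) =
      Submodule.span ℚ (M : Set (Ω → ℚ)) := by
    rw [Algebra.adjoin_eq_span, Submonoid.closure_eq]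
  rw [← hspan, Subalgebra.mem_toSubmodule]
  have hsep : ∀ b, ∃ f ∈ M, ¬ Indistinguishable M a b → f a ≠ f b := by
    intro b
    by_cases h : Indistinguishable M a b
    · exact ⟨1, M.one_mem, fun h' => (h' h).elim⟩
    · unfold Indistinguishable at h
      push Not at h
      obtain ⟨f, hf, hne⟩ := h
      exact ⟨f, hf, fun _ => hne⟩
  choose f hfM hf using hsep
  -- A Lagrange product: the factor for `b` is 1 on the class of `a` and vanishes at `b`.
  have heq : (fun c => if Indistinguishable M a c then 1 else 0) =
      ∏ b ∈ Finset.univ.filter (fun b => ¬ Indistinguishable M a b),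
        ((f b a - f b b)⁻¹ • (f b - algebraMap ℚ (Ω → ℚ) (f b b))) := by
    funext c
    rw [Finset.prod_apply]
    split_ifs with hc
    · symm
      refine Finset.prod_eq_one fun b hb => ?_
      have hne := sub_ne_zero.2 (hf b (Finset.mem_filter.1 hb).2)
      simp only [Pi.smul_apply, Pi.sub_apply, Pi.algebraMap_apply, Algebra.algebraMap_self,
        RingHom.id_apply, smul_eq_mul]
      rw [← hc (f b) (hfM b), inv_mul_cancel₀ hne]
    · symm
      refine Finset.prod_eq_zero (Finset.mem_filter.2 ⟨Finset.mem_univ c, hc⟩) ?_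
      simp
  rw [heq]
  refine Subalgebra.prod_mem _ fun b _ => Subalgebra.smul_mem _ ?_ _
  exact Subalgebra.sub_mem _ (Algebra.subset_adjoin (hfM b)) (Subalgebra.algebraMap_mem _ _)

end Separation

/-! ### A coupling from a balanced equivalence relation -/

section Coupling

variable {V W : Type*} [Fintype V] [Fintype W] {m : ℕ}

/-- Summation of a function on tuples over all values of the `j`-th entry. -/
def sumAt {V W : Type*} [Fintype V] [Fintype W] {m : ℕ} (j : Fin m)
    (f : (Fin m → V) ⊕ (Fin m → W) → ℚ) : (Fin m → V) ⊕ (Fin m → W) → ℚ :=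
  Sum.elim (fun v => ∑ b, f (.inl (Function.update v j b)))
    (fun w => ∑ c, f (.inr (Function.update w j c)))

theorem sum_mul_sum_update_comm {ι : Type*} [Fintype ι] [DecidableEq ι] (j : ι)
    (φ ψ : (ι → V) → ℚ) :
    ∑ v, φ v * ∑ b, ψ (Function.update v j b) = ∑ v, ψ v * ∑ b, φ (Function.update v j b) := by
  have hinv : Function.Involutive
      (fun p : (ι → V) × V => (Function.update p.1 j p.2, p.1 j)) := by
    rintro ⟨h, b⟩
    simp
  simp only [Finset.mul_sum]
  rw [← Fintype.sum_prod_type', ← Fintype.sum_prod_type']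
  refine Fintype.sum_equiv hinv.toPerm _ _ fun p => ?_
  simp [mul_comm]

open Classical in
/-- Uniform weights on the classes of an equivalence relation on tuples that is balanced, refines
the atomic type and is respected by summation at a position. -/
theorem exists_isTupleCoupling (G : SimpleGraph V) (H : SimpleGraph W)
    (r : (Fin m → V) ⊕ (Fin m → W) → (Fin m → V) ⊕ (Fin m → W) → Prop) (hr : Equivalence r)
    (hbal : ∀ a, ∑ v, (if r a (.inl v) then (1 : ℚ) else 0) =
      ∑ w, if r a (.inr w) then (1 : ℚ) else 0)
    (heq : ∀ v w, r (.inl v) (.inr w) → ∀ i j, v i = v j ↔ w i = w j)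
    (hadj : ∀ v w, r (.inl v) (.inr w) → ∀ i j, G.Adj (v i) (v j) ↔ H.Adj (w i) (w j))
    (hsum : ∀ a b c j, r b c → sumAt j (fun x => if r a x then 1 else 0) b =
      sumAt j (fun x => if r a x then 1 else 0) c) :
    ∃ X : Matrix (Fin m → W) (Fin m → V) ℚ,
      IsTupleCoupling m G H X ∧ ∀ w v, 0 ≤ X w v := by
  set n : (Fin m → V) ⊕ (Fin m → W) → ℚ := fun a => ∑ v, if r a (.inl v) then 1 else 0 with hn
  have hcongr : ∀ a b, r a b → ∀ x, r a x ↔ r b x := fun a b hab x =>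
    ⟨hr.trans (hr.symm hab), hr.trans hab⟩
  have hn_congr : ∀ a b, r a b → n a = n b := fun a b hab => by
    simp only [hn, hcongr a b hab]
  have hpos : ∀ a, 0 < n a := by
    have h0 : ∀ a x, (0 : ℚ) ≤ if r a x then 1 else 0 := fun a x => by split_ifs <;> simp
    rintro (v | w)
    · refine Finset.sum_pos' (fun x _ => h0 _ _) ⟨v, Finset.mem_univ _, ?_⟩
      rw [if_pos (hr.refl _)]
      exact one_pos
    · rw [show n (.inr w) = _ from hbal _]
      refine Finset.sum_pos' (fun x _ => h0 _ _) ⟨w, Finset.mem_univ _, ?_⟩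
      rw [if_pos (hr.refl _)]
      exact one_pos
  -- Double counting of pairs of `V`-tuples, one in each class, that agree off position `j`. Balance
  -- makes it suffice to count over `V`, even when `a` or `b` is a `W`-tuple.
  have hswap : ∀ (a b) (j : Fin m), n b * sumAt j (fun x => if r a x then 1 else 0) b =
      n a * sumAt j (fun x => if r b x then 1 else 0) a := by
    have h1 : ∀ (a b) (j : Fin m), n b * sumAt j (fun x => if r a x then 1 else 0) b =
        ∑ v, (if r b (.inl v) then (1 : ℚ) else 0) *
          ∑ c, if r a (.inl (Function.update v j c)) then (1 : ℚ) else 0 := by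
      intro a b j
      rw [hn, Finset.sum_mul]
      refine Finset.sum_congr rfl fun v _ => ?_
      split_ifs with hv
      · rw [hsum a b _ j hv]
        rfl
      · simp
    intro a b j
    rw [h1, h1]
    exact sum_mul_sum_update_comm j (fun v => if r b (.inl v) then (1 : ℚ) else 0)
      (fun v => if r a (.inl v) then (1 : ℚ) else 0)
  have hX : ∀ w v, (if r (.inl v) (.inr w) then (n (.inl v))⁻¹ else 0) =
      if r (.inr w) (.inl v) then (n (.inr w))⁻¹ else 0 := by
    intro w v
    by_cases h : r (.inl v) (.inr w)
    · rw [if_pos h, if_pos (hr.symm h), hn_congr _ _ h]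
    · rw [if_neg h, if_neg fun h' => h (hr.symm h')]
  have hX0 : ∀ w v, (if r (.inl v) (.inr w) then (n (.inl v))⁻¹ else 0) ≠ 0 →
      r (.inl v) (.inr w) := by
    intro w v h
    by_contra hn
    exact h (if_neg hn)
  refine ⟨fun w v => if r (.inl v) (.inr w) then (n (.inl v))⁻¹ else 0,
    ⟨fun w => ?_, fun v => ?_, fun w v h => heq v w (hX0 w v h), fun w v h => hadj v w (hX0 w v h),
      fun w v j => ?_⟩, fun w v => ?_⟩
  · simp only [hX]
    have : ∀ v, (if r (.inr w) (.inl v) then (n (.inr w))⁻¹ else 0) =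
        (n (.inr w))⁻¹ * if r (.inr w) (.inl v) then 1 else 0 := fun v => by simp
    simp only [this]
    rw [← Finset.mul_sum]
    exact inv_mul_cancel₀ (hpos _).ne'
  · have : ∀ w, (if r (.inl v) (.inr w) then (n (.inl v))⁻¹ else 0) =
        (n (.inl v))⁻¹ * if r (.inl v) (.inr w) then 1 else 0 := fun v => by simp
    simp only [this]
    rw [← Finset.mul_sum, ← hbal]
    exact inv_mul_cancel₀ (hpos _).ne'
  · have h1 : ∑ b, (if r (.inl (Function.update v j b)) (.inr w) then
        (n (.inl (Function.update v j b)))⁻¹ else 0) =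
        (n (.inr w))⁻¹ * sumAt j (fun x => if r (.inr w) x then 1 else 0) (.inl v) := by
      simp only [hX]
      rw [sumAt, Sum.elim_inl, Finset.mul_sum]
      exact Finset.sum_congr rfl fun b _ => by simp
    have h2 : ∑ c, (if r (.inl v) (.inr (Function.update w j c)) then (n (.inl v))⁻¹ else 0) =
        (n (.inl v))⁻¹ * sumAt j (fun x => if r (.inl v) x then 1 else 0) (.inr w) := by
      rw [sumAt, Sum.elim_inr, Finset.mul_sum]
      exact Finset.sum_congr rfl fun b _ => by simp
    rw [h1, h2, inv_mul_eq_iff_eq_mul₀ (hpos _).ne', mul_left_comm,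
      eq_inv_mul_iff_mul_eq₀ (hpos _).ne']
    exact hswap (.inr w) (.inl v) j
  · beta_reduce
    split_ifs
    · exact (inv_pos.2 (hpos _)).le
    · exact le_rfl

end Coupling

/-! ### The algebra of queries and the coupling it defines -/

section Queries

variable {V W : Type*} [Fintype V] [Fintype W] {m : ℕ}

/-- The values of a query in both graphs. -/
noncomputable def TreeQuery.pairValue (Q : TreeQuery m) (G : SimpleGraph V) (H : SimpleGraph W) :
    (Fin m → V) ⊕ (Fin m → W) → ℚ :=
  Sum.elim (Q.value G) (Q.value H)

theorem TreeQuery.value_attach_univ (Q Q' : TreeQuery m) (G : SimpleGraph V) :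
    (attach Set.univ Q Q').value G = Q.value G * Q'.value G := by
  classical
  funext x
  rw [value_attach, Pi.mul_apply]
  congr 1
  have : ∀ y : Fin m → V, (∀ i ∈ Set.univ, x i = y i) ↔ x = y := fun y => by
    simp [funext_iff]
  simp only [this, Finset.sum_ite_eq, Finset.mem_univ, if_true]

theorem TreeQuery.value_single_bot (G : SimpleGraph V) :
    (single (m := m) (fun _ _ => False) fun _ _ => False).value G = 1 := by
  classical
  funext x
  rw [value_single]
  simp

/-- The new root is unconstrained and shares every variable but `j` with the old root, whose `j`-th
value is thus free. -/
theorem TreeQuery.value_forget (Q : TreeQuery m) (G : SimpleGraph V) (j : Fin m)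
    (x : Fin m → V) :
    (attach {j}ᶜ (single (fun _ _ => False) fun _ _ => False) Q).value G x =
      ∑ b, Q.value G (Function.update x j b) := by
  classical
  rw [value_attach, value_single_bot, Pi.one_apply, one_mul,
    ← sum_ite_agree_off (fun y => Q.value G y) j x]
  refine Finset.sum_congr rfl fun y _ => ?_
  rw [mul_ite, mul_one, mul_zero]
  have h : (∀ i ∈ ({j}ᶜ : Set (Fin m)), x i = y i) ↔ ∀ i, i ≠ j → y i = x i :=
    forall_congr' fun i => by simp [eq_comm]
  by_cases hy : ∀ i, i ≠ j → y i = x i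
  · rw [if_pos hy, if_pos (h.2 hy)]
  · rw [if_neg hy, if_neg (mt h.1 hy)]

/-- The functions on tuples defined by queries. -/
noncomputable def queryMonoid (m : ℕ) (G : SimpleGraph V) (H : SimpleGraph W) :
    Submonoid ((Fin m → V) ⊕ (Fin m → W) → ℚ) where
  carrier := Set.range fun Q : TreeQuery m => Q.pairValue G H
  one_mem' := ⟨.single (fun _ _ => False) fun _ _ => False, by
    simp only [TreeQuery.pairValue, TreeQuery.value_single_bot]
    funext a
    cases a <;> rfl⟩
  mul_mem' := by
    rintro _ _ ⟨Q, rfl⟩ ⟨Q', rfl⟩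
    refine ⟨.attach Set.univ Q Q', ?_⟩
    simp only [TreeQuery.pairValue, TreeQuery.value_attach_univ]
    funext a
    cases a <;> rfl

theorem sumAt_mem_span {G : SimpleGraph V} {H : SimpleGraph W} (j : Fin m)
    {f : (Fin m → V) ⊕ (Fin m → W) → ℚ}
    (hf : f ∈ Submodule.span ℚ (queryMonoid m G H : Set ((Fin m → V) ⊕ (Fin m → W) → ℚ))) :
    sumAt j f ∈ Submodule.span ℚ (queryMonoid m G H : Set ((Fin m → V) ⊕ (Fin m → W) → ℚ)) := by
  induction hf using Submodule.span_induction with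
  | mem f hf =>
    obtain ⟨Q, rfl⟩ := hf
    refine Submodule.subset_span
      ⟨.attach {j}ᶜ (.single (fun _ _ => False) fun _ _ => False) Q, ?_⟩
    funext a
    cases a <;> exact TreeQuery.value_forget _ _ _ _
  | zero =>
    convert Submodule.zero_mem _ using 1
    funext a
    cases a <;> simp [sumAt]
  | add f g _ _ hf hg =>
    convert Submodule.add_mem _ hf hg using 1
    funext a
    cases a <;> simp [sumAt, Finset.sum_add_distrib]
  | smul c f _ hf =>
    convert Submodule.smul_mem _ c hf using 1
    funext a
    cases a <;> simp [sumAt, Finset.mul_sum]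

theorem sum_eq_of_mem_span {k : ℕ} {G : SimpleGraph V} {H : SimpleGraph W}
    (hGH : HomIndistinguishableTreewidth k G H)
    {f : (Fin (k + 1) → V) ⊕ (Fin (k + 1) → W) → ℚ}
    (hf : f ∈ Submodule.span ℚ
      (queryMonoid (k + 1) G H : Set ((Fin (k + 1) → V) ⊕ (Fin (k + 1) → W) → ℚ))) :
    ∑ v, f (.inl v) = ∑ w, f (.inr w) := by
  induction hf using Submodule.span_induction with
  | mem f hf =>
    obtain ⟨Q, rfl⟩ := hf
    exact Q.sum_value_eq hGH
  | zero => simp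
  | add f g _ _ hf hg => simp [Finset.sum_add_distrib, hf, hg]
  | smul c f _ hf => simp [← Finset.mul_sum, hf]

theorem HomIndistinguishableTreewidth.exists_isTupleCoupling {k : ℕ} {G : SimpleGraph V}
    {H : SimpleGraph W} (hGH : HomIndistinguishableTreewidth k G H) :
    ∃ X : Matrix (Fin (k + 1) → W) (Fin (k + 1) → V) ℚ,
      IsTupleCoupling (k + 1) G H X ∧ ∀ w v, 0 ≤ X w v := by
  classical
  -- One-node queries test any set of equalities and adjacencies, so indistinguishable tuples have
  -- the same atomic type.
  have hatom : ∀ (same edge : Fin (k + 1) → Fin (k + 1) → Prop) v w,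
      Indistinguishable (queryMonoid (k + 1) G H) (.inl v) (.inr w) →
      (((∀ i j, same i j → v i = v j) ∧ ∀ i j, edge i j → G.Adj (v i) (v j)) ↔
        ((∀ i j, same i j → w i = w j) ∧ ∀ i j, edge i j → H.Adj (w i) (w j))) := by
    intro same edge v w h
    have h1 := h _ ⟨.single same edge, rfl⟩
    simp only [TreeQuery.pairValue, Sum.elim_inl, Sum.elim_inr, TreeQuery.value_single] at h1
    split_ifs at h1 with h2 h3 h3
    · exact iff_of_true h2 h3
    · simp at h1
    · simp at h1
    · exact iff_of_false h2 h3
  refine _root_.exists_isTupleCoupling G H (Indistinguishable (queryMonoid (k + 1) G H))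
    ⟨fun _ _ _ => rfl, Indistinguishable.symm, Indistinguishable.trans⟩
    (fun a => sum_eq_of_mem_span hGH (indicator_mem_span _ a)) (fun v w h i j => ?_)
    (fun v w h i j => ?_)
    (fun a b c j hbc => hbc.eq_of_mem_span (sumAt_mem_span j (indicator_mem_span _ a)))
  · have := hatom (fun a b => a = i ∧ b = j) (fun _ _ => False) v w h
    simpa using this
  · have := hatom (fun _ _ => False) (fun a b => a = i ∧ b = j) v w h
    simpa using this

end Queries

theorem mainTheorem11 {V W : Type*} [Fintype V] [Fintype W] [DecidableEq V] [DecidableEq W]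
    (k : ℕ) (hk : 1 ≤ k) (G : SimpleGraph V) (H : SimpleGraph W) :
    List.TFAE [
      HomIndistinguishableTreewidth k G H,
      ∃ X : Matrix (Fin (k + 1) → W) (Fin (k + 1) → V) ℚ,
        IsPWSolution k G H X ∧ ∀ w v, 0 ≤ X w v,
      ∃ Y : Finset (W × V) → ℚ,
        IsLisoSolution k G H Y ∧ ∀ π : Finset (W × V), π.card ≤ k + 1 → 0 ≤ Y π] := by
  tfae_have 1 → 2 := fun h => by
    obtain ⟨X, hX, h0⟩ := h.exists_isTupleCoupling
    exact ⟨X, (isPWSolution_iff k G H X).2 hX, h0⟩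
  tfae_have 2 → 3 := fun ⟨X, hX, h0⟩ =>
    ⟨_, ((isPWSolution_iff k G H X).1 hX).isLisoSolution, fun π _ =>
      ofTuples_nonneg (fun _ => symmetrize_nonneg h0 _ _) π⟩
  tfae_have 3 → 1 := fun ⟨Y, hY, h0⟩ => hY.homIndistinguishableTreewidth h0
  tfae_finish
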